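/- Let $d\ge 4$ and $\ell\ge 1$ be integers, let $m\in\{-\ell,\,1,\,\ell+d-2\}$, and let $\lambda\in\mathbb C$ with $\operatorname{Re}\lambda\ge 0$. Distinguish the four cases (i) $\ell=1,\ m=d-1$; (ii) $\ell=1,\ m=1$; (iii) $\ell=2,\ m=d$; (iv) all others. Consider on $(0,1)$ the Heun equation $$h''(x)+p(x)h'(x)+q(x)h(x)=0,\qquad (\ast)$$ where $$p(x)=\begin{cases}\frac{d+4}{2x}+\frac{2\lambda+3-d}{2(x-1)}&\text{(i), (ii)}\\[2pt] \frac{d+6}{2x}+\frac{2\lambda+3-d}{2(x-1)}&\text{(iii)}\\[2pt] \frac{d+2\ell}{2x}+\frac{2\lambda+3-d}{2(x-1)}-\frac{2}{d-2+x}&\text{(iv)}\end{cases}$$ and $q(x)=\dfrac{Q(x)}{4x(x-1)(d-2+x)}$ with $$Q(x)=\begin{cases}(d-2)\lambda^2+5(d-2)\lambda+2d-8+(\lambda+2)(\lambda+3)x&\text{(i)}\\ (d-2)\lambda^2+5(d-2)\lambda+4d-12+(\lambda+1)(\lambda+4)x&\text{(ii)}\\ (d-2)\lambda^2+7(d-2)\lambda+8d-24+(\lambda+3)(\lambda+4)x&\text{(iii)}\\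 (d-2)\ell^2+(d+2)\ell+(d-2)\lambda(2\ell+\lambda+1)+4-2d-4m+(\lambda+\ell-1)(\lambda+\ell-2)x&\text{(iv).}\end{cases}$$ For integers $n\ge -1$ put $$A_n=\begin{cases}\frac{4(d-3)n^2+[4(d-2)\lambda+16(d-3)]n+(d-2)\lambda^2+9(d-2)\lambda+14d-44}{2(d-2)(n+2)(2n+d+6)}&\text{(i)}\\[3pt] \frac{4(d-3)n^2+[4(d-2)\lambda+16(d-3)]n+(d-2)\lambda^2+9(d-2)\lambda+16(d-3)}{2(d-2)(n+2)(2n+d+6)}&\text{(ii)}\\[3pt] \frac{4(d-3)n^2+[4(d-2)\lambda+20(d-3)]n+(d-2)\lambda^2+11(d-2)\lambda+24(d-3)}{2(d-2)(n+2)(2n+d+8)}&\text{(iii)}\\[3pt] \frac{4(d-3)n^2+[4(d-2)\lambda+4(d-3)\ell+8d-16]n+(d-2)\lambda^2+(d-2)(2\ell+5)\lambda+(d-2)\ell^2+5(d-2)\ell+2d-4m}{2(d-2)(n+2)(2n+2\ell+d+2)}&\text{(iv)}\end{cases}$$ $$B_n=\begin{cases}\frac{(2n+\lambda+2)(2n+\lambda+3)}{2(d-2)(n+2)(2n+d+6)}&\text{(i)}\\[3pt]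 \frac{(2n+\lambda+1)(2n+\lambda+4)}{2(d-2)(n+2)(2n+d+6)}&\text{(ii)}\\[3pt] \frac{(2n+\lambda+3)(2n+\lambda+4)}{2(d-2)(n+2)(2n+d+8)}&\text{(iii)}\\[3pt] \frac{(2n+\lambda+\ell-2)(2n+\lambda+\ell-1)}{2(d-2)(n+2)(2n+2\ell+d+2)}&\text{(iv)}\end{cases}$$ and define $(a_n)_{n\ge -1}$ by $a_{-1}=0$, $a_0=1$ and $a_{n+2}=A_na_{n+1}+B_na_n$ for $n\ge -1$. Then: 1. $a_n\ne 0$ for all sufficiently large $n$, and $r_n:=a_{n+1}/a_n$ satisfies $\lim_{n\to\infty}r_n=1$. 2. The power series $h(x)=\sum_{n\ge 0}a_nx^n$ has radius of convergence $1$. Its sum solves $(\ast)$ on $(0,1)$, and every solution of $(\ast)$ on $(0,1)$ that extends to a $C^\infty$ function on $[0,\varepsilon)$ for some $\varepsilon>0$ is a constant multiple of $h$. 3. $h$ is not smooth on $[0,1]$: there is no function in $C^\infty([0,1])$ that coincides with $h$ on $[0,1)$. -/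

import Mathlib

open Filter Topology Set
open scoped ContDiff

/-- The coefficient `A_n(λ)` of the recurrence for the power series coefficients.
The index is an integer, since the recurrence starts at `n = -1`. -/
noncomputable def coeffA (d l : ℕ) (m : ℤ) (n : ℤ) (z : ℂ) : ℂ :=
  if l = 1 ∧ m = (d : ℤ) - 1 then
    (4 * ((d : ℂ) - 3) * (n : ℂ) ^ 2 + (4 * ((d : ℂ) - 2) * z + 16 * ((d : ℂ) - 3)) * (n : ℂ)
        + ((d : ℂ) - 2) * z ^ 2 + 9 * ((d : ℂ) - 2) * z + 14 * (d : ℂ) - 44)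
      / (2 * ((d : ℂ) - 2) * ((n : ℂ) + 2) * (2 * (n : ℂ) + (d : ℂ) + 6))
  else if l = 1 ∧ m = 1 then
    (4 * ((d : ℂ) - 3) * (n : ℂ) ^ 2 + (4 * ((d : ℂ) - 2) * z + 16 * ((d : ℂ) - 3)) * (n : ℂ)
        + ((d : ℂ) - 2) * z ^ 2 + 9 * ((d : ℂ) - 2) * z + 16 * ((d : ℂ) - 3))
      / (2 * ((d : ℂ) - 2) * ((n : ℂ) + 2) * (2 * (n : ℂ) + (d : ℂ) + 6))
  else if l = 2 ∧ m = (d : ℤ) then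
    (4 * ((d : ℂ) - 3) * (n : ℂ) ^ 2 + (4 * ((d : ℂ) - 2) * z + 20 * ((d : ℂ) - 3)) * (n : ℂ)
        + ((d : ℂ) - 2) * z ^ 2 + 11 * ((d : ℂ) - 2) * z + 24 * ((d : ℂ) - 3))
      / (2 * ((d : ℂ) - 2) * ((n : ℂ) + 2) * (2 * (n : ℂ) + (d : ℂ) + 8))
  else
    (4 * ((d : ℂ) - 3) * (n : ℂ) ^ 2
        + (4 * ((d : ℂ) - 2) * z + 4 * ((d : ℂ) - 3) * (l : ℂ) + 8 * (d : ℂ) - 16) * (n : ℂ)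
        + ((d : ℂ) - 2) * z ^ 2 + ((d : ℂ) - 2) * (2 * (l : ℂ) + 5) * z
        + ((d : ℂ) - 2) * (l : ℂ) ^ 2 + 5 * ((d : ℂ) - 2) * (l : ℂ) + 2 * (d : ℂ) - 4 * (m : ℂ))
      / (2 * ((d : ℂ) - 2) * ((n : ℂ) + 2) * (2 * (n : ℂ) + 2 * (l : ℂ) + (d : ℂ) + 2))

/-- The coefficient `B_n(λ)` of the recurrence for the power series coefficients. -/
noncomputable def coeffB (d l : ℕ) (m : ℤ) (n : ℤ) (z : ℂ) : ℂ :=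
  if l = 1 ∧ m = (d : ℤ) - 1 then
    ((2 * (n : ℂ) + z + 2) * (2 * (n : ℂ) + z + 3))
      / (2 * ((d : ℂ) - 2) * ((n : ℂ) + 2) * (2 * (n : ℂ) + (d : ℂ) + 6))
  else if l = 1 ∧ m = 1 then
    ((2 * (n : ℂ) + z + 1) * (2 * (n : ℂ) + z + 4))
      / (2 * ((d : ℂ) - 2) * ((n : ℂ) + 2) * (2 * (n : ℂ) + (d : ℂ) + 6))
  else if l = 2 ∧ m = (d : ℤ) then
    ((2 * (n : ℂ) + z + 3) * (2 * (n : ℂ) + z + 4))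
      / (2 * ((d : ℂ) - 2) * ((n : ℂ) + 2) * (2 * (n : ℂ) + (d : ℂ) + 8))
  else
    ((2 * (n : ℂ) + z + (l : ℂ) - 2) * (2 * (n : ℂ) + z + (l : ℂ) - 1))
      / (2 * ((d : ℂ) - 2) * ((n : ℂ) + 2) * (2 * (n : ℂ) + 2 * (l : ℂ) + (d : ℂ) + 2))

/-- The coefficients `a_n(λ)`: with `a_{-1} = 0` and `a_0 = 1`, they satisfy
`a_{n+2} = A_n a_{n+1} + B_n a_n` for all `n ≥ -1`; for `n = -1` this reads `a_1 = A_{-1}`. -/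
noncomputable def heunCoeff (d l : ℕ) (m : ℤ) (z : ℂ) : ℕ → ℂ
  | 0 => 1
  | 1 => coeffA d l m (-1) z
  | n + 2 => coeffA d l m (n : ℤ) z * heunCoeff d l m z (n + 1)
      + coeffB d l m (n : ℤ) z * heunCoeff d l m z n

/-- The ratios `r_n(λ) = a_{n+1}(λ) / a_n(λ)` (meaningful where `a_n(λ) ≠ 0`). -/
noncomputable def heunRatio (d l : ℕ) (m : ℤ) (z : ℂ) (n : ℕ) : ℂ :=
  heunCoeff d l m z (n + 1) / heunCoeff d l m z n

/-- The coefficient of `h'` in the Heun equation in standard form. -/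
noncomputable def heunP (d l : ℕ) (m : ℤ) (z : ℂ) (x : ℝ) : ℂ :=
  if l = 1 ∧ m = (d : ℤ) - 1 then
    ((d : ℂ) + 4) / (2 * (x : ℂ)) + (2 * z + 3 - (d : ℂ)) / (2 * ((x : ℂ) - 1))
  else if l = 1 ∧ m = 1 then
    ((d : ℂ) + 4) / (2 * (x : ℂ)) + (2 * z + 3 - (d : ℂ)) / (2 * ((x : ℂ) - 1))
  else if l = 2 ∧ m = (d : ℤ) then
    ((d : ℂ) + 6) / (2 * (x : ℂ)) + (2 * z + 3 - (d : ℂ)) / (2 * ((x : ℂ) - 1))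
  else
    ((d : ℂ) + 2 * (l : ℂ)) / (2 * (x : ℂ)) + (2 * z + 3 - (d : ℂ)) / (2 * ((x : ℂ) - 1))
      - 2 / ((d : ℂ) - 2 + (x : ℂ))

/-- The coefficient of `h` in the Heun equation in standard form. -/
noncomputable def heunQ (d l : ℕ) (m : ℤ) (z : ℂ) (x : ℝ) : ℂ :=
  (if l = 1 ∧ m = (d : ℤ) - 1 then
    ((d : ℂ) - 2) * z ^ 2 + 5 * ((d : ℂ) - 2) * z + 2 * (d : ℂ) - 8
      + (z + 2) * (z + 3) * (x : ℂ)
  else if l = 1 ∧ m = 1 then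
    ((d : ℂ) - 2) * z ^ 2 + 5 * ((d : ℂ) - 2) * z + 4 * (d : ℂ) - 12
      + (z + 1) * (z + 4) * (x : ℂ)
  else if l = 2 ∧ m = (d : ℤ) then
    ((d : ℂ) - 2) * z ^ 2 + 7 * ((d : ℂ) - 2) * z + 8 * (d : ℂ) - 24
      + (z + 3) * (z + 4) * (x : ℂ)
  else
    ((d : ℂ) - 2) * (l : ℂ) ^ 2 + ((d : ℂ) + 2) * (l : ℂ)
      + ((d : ℂ) - 2) * z * (2 * (l : ℂ) + z + 1) + 4 - 2 * (d : ℂ) - 4 * (m : ℂ)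
      + (z + (l : ℂ) - 1) * (z + (l : ℂ) - 2) * (x : ℂ))
    / (4 * (x : ℂ) * ((x : ℂ) - 1) * ((d : ℂ) - 2 + (x : ℂ)))

/-- `f` is a (classical, twice differentiable) solution of the Heun equation
`f'' + p f' + q f = 0` on the open interval `(0, 1)`. -/
def SolvesHeun (d l : ℕ) (m : ℤ) (z : ℂ) (f : ℝ → ℂ) : Prop :=
  ∀ x ∈ Ioo (0 : ℝ) 1, DifferentiableAt ℝ f x ∧ DifferentiableAt ℝ (deriv f) x ∧
    deriv (deriv f) x + heunP d l m z x * deriv f x + heunQ d l m z x * f x = 0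

/-- The sum `h(x) = ∑ a_n(λ) x^n` of the Heun series. -/
noncomputable def heunSeries (d l : ℕ) (m : ℤ) (z : ℂ) (x : ℝ) : ℂ :=
  ∑' n : ℕ, heunCoeff d l m z n * (x : ℂ) ^ n

/-! Put D = d - 2 ≥ 2 and b = 1/D; the singular points of the equation are 0, 1 and -D. The ratios r
of the coefficients satisfy a recursion r' = A + B / r whose limit r ↦ 1 - b + b / r has the
attracting fixed point 1 and the repelling fixed point -b. Everything hinges on excluding the limit
-b, which would make h analytic across x = 1.

This is where Re λ ≥ 0 enters. The normalised ratio s n = 4(n+1)(n+γ) (a (n+1) / a n) / (2n+κ) obeys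
s' = v + e - c/v + (α/D) β/s with v = 2n+2+κ. Here κ and e are chosen so that c is real and
independent of λ, and β is close to the positive reals. As Re v is large and 1/s lies in a disc when
Re s ≥ p > 0, an explicit lower bound for Re s that grows linearly in n is propagated by induction
(`half_plane_step`). The first indices need separate care in each of the four families.

Once the ratios stay in a half-plane, the Möbius coordinate (r - 1)/(r + b) turns the recursion into
a perturbed contraction, which gives r = 1 + ρ/n + O(1/n²) (`exists_ratio_expansion`). Hence the
radius of convergence is 1, and a n is asymptotic to a nonzero multiple of the Taylor coefficients
of (1-x)^(-ρ-1). If Re ρ > -1, then h is unbounded near 1. Each differentiation raises ρ by 1, so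
some derivative of h is always unbounded there, and h is not smooth at 1
(`HasRatioExpansion.not_smooth`).

For uniqueness, f - f(0) h vanishes at 0, and a Grönwall estimate for |u'|² + |u/x|² shows that a
smooth solution u with u(0) = 0 is zero (`SolvesLinear.eq_zero_of_smooth`). -/

/-! ### Asymptotics of the ratio recursion. -/

/-- A perturbed contraction inherits the decay rate `(n + 1)⁻ʲ` of its perturbation. -/
lemma isBigO_inv_pow_of_contraction {x : ℕ → ℂ} {q C : ℝ} (hq0 : 0 ≤ q) (hq : q < 1) (j : ℕ)
    (h : ∀ᶠ n : ℕ in atTop, ‖x (n + 1)‖ ≤ q * ‖x n‖ + C * (((n : ℝ) + 1)⁻¹) ^ j) :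
    x =O[atTop] fun n : ℕ => (((n : ℝ) + 1)⁻¹) ^ j := by
  have hlim : Tendsto (fun n : ℕ => (((n : ℝ) + 2) / ((n : ℝ) + 1)) ^ j) atTop (𝓝 1) := by
    have h1 : Tendsto (fun n : ℕ => ((n : ℝ) + 2) / ((n : ℝ) + 1)) atTop (𝓝 1) := by
      have h2 := (tendsto_one_div_add_atTop_nhds_zero_nat (𝕜 := ℝ)).const_add 1
      rw [add_zero] at h2
      refine h2.congr fun n => ?_
      have : (n : ℝ) + 1 ≠ 0 := by positivity
      field_simp
      ring
    simpa using h1.pow j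
  have hq' : ∀ᶠ n : ℕ in atTop, q * (((n : ℝ) + 2) / ((n : ℝ) + 1)) ^ j < (1 + q) / 2 := by
    have := hlim.const_mul q
    exact this.eventually_lt_const (by linarith)
  have h2' : ∀ᶠ n : ℕ in atTop, (((n : ℝ) + 2) / ((n : ℝ) + 1)) ^ j < 2 :=
    hlim.eventually_lt_const (by norm_num)
  obtain ⟨N, hN⟩ := eventually_atTop.1 (h.and (hq'.and h2'))
  set y : ℕ → ℝ := fun n => ‖x n‖ * ((n : ℝ) + 1) ^ j with hy
  have hstep : ∀ n ≥ N, y (n + 1) ≤ (1 + q) / 2 * y n + 2 * |C| := by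
    intro n hn
    obtain ⟨h1, h2, h3⟩ := hN n hn
    have hp : (0 : ℝ) < ((n : ℝ) + 1) ^ j := by positivity
    have hp2 : (0 : ℝ) < ((n : ℝ) + 2) ^ j := by positivity
    have hd : (((n : ℝ) + 2) / ((n : ℝ) + 1)) ^ j * ((n : ℝ) + 1) ^ j = ((n : ℝ) + 2) ^ j := by
      rw [div_pow, div_mul_cancel₀ _ hp.ne']
    have e1 : y (n + 1) = ‖x (n + 1)‖ * ((n : ℝ) + 2) ^ j := by
      simp only [hy]; push_cast; ring_nf
    have e2 : (((n : ℝ) + 1)⁻¹) ^ j * ((n : ℝ) + 2) ^ j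
        = (((n : ℝ) + 2) / ((n : ℝ) + 1)) ^ j := by
      rw [← mul_pow, div_eq_inv_mul]
    calc y (n + 1) ≤ (q * ‖x n‖ + C * (((n : ℝ) + 1)⁻¹) ^ j) * ((n : ℝ) + 2) ^ j := by
          rw [e1]; gcongr
      _ = q * (((n : ℝ) + 2) / ((n : ℝ) + 1)) ^ j * y n
          + C * (((n : ℝ) + 2) / ((n : ℝ) + 1)) ^ j := by
          rw [add_mul, mul_assoc C, e2, ← hd]; ring
      _ ≤ (1 + q) / 2 * y n + |C| * 2 := by
          have hy0 : 0 ≤ y n := by simp only [hy]; positivity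
          have hr0 : 0 ≤ (((n : ℝ) + 2) / ((n : ℝ) + 1)) ^ j := by positivity
          have := mul_le_mul (le_abs_self C) h3.le hr0 (abs_nonneg C)
          have := mul_le_mul_of_nonneg_right h2.le hy0
          linarith
      _ = _ := by ring
  -- The value 4|C|/(1-q) is the fixed point of y ↦ (1+q)/2 · y + 2|C|.
  have hbd : ∀ n ≥ N, y n ≤ max (y N) (4 * |C| / (1 - q)) := by
    intro n hn
    induction n, hn using Nat.le_induction with
    | base => exact le_max_left _ _
    | succ n hn ih =>
      refine (hstep n hn).trans ?_
      set Mx := max (y N) (4 * |C| / (1 - q))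
      have h1 : 4 * |C| / (1 - q) ≤ Mx := le_max_right _ _
      rw [div_le_iff₀ (by linarith)] at h1
      have := mul_le_mul_of_nonneg_left ih (show 0 ≤ (1 + q) / 2 by linarith)
      nlinarith
  refine Asymptotics.IsBigO.of_bound (max (y N) (4 * |C| / (1 - q))) ?_
  filter_upwards [eventually_ge_atTop N] with n hn
  have hp : (0 : ℝ) < ((n : ℝ) + 1) ^ j := by positivity
  rw [Real.norm_of_nonneg (by positivity), inv_pow, ← div_eq_mul_inv, le_div_iff₀ hp]
  exact hbd n hn

lemma tendsto_inv_natCast_add_one :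
    Tendsto (fun n : ℕ => ((n : ℝ) + 1)⁻¹) atTop (𝓝 0) := by
  simpa [one_div] using tendsto_one_div_add_atTop_nhds_zero_nat (𝕜 := ℝ)

/-- A sequence satisfying `r (n + 1) = A n + B n / r n` whose members asymptotically stay in a
half-plane to the right of the origin is bounded and bounded away from the imaginary axis. -/
lemma eventually_bounds_of_half_plane {r A B e : ℕ → ℂ} {a b c : ℝ} (hc : 0 < c)
    (hA : Tendsto A atTop (𝓝 a)) (hB : Tendsto B atTop (𝓝 b))
    (he : Tendsto e atTop (𝓝 (1 / 2)))
    (hr : ∀ᶠ n in atTop, r (n + 1) = A n + B n / r n)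
    (hre : ∀ᶠ n in atTop, c ≤ (e n * r n).re) :
    ∃ K : ℝ, ∀ᶠ n in atTop, ‖r n‖ ≤ K ∧ c ≤ (r n).re := by
  have hA' : ∀ᶠ n in atTop, ‖A n‖ < |a| + 1 :=
    hA.norm.eventually_lt_const (by simp)
  have hB' : ∀ᶠ n in atTop, ‖B n‖ < |b| + 1 :=
    hB.norm.eventually_lt_const (by simp)
  have he' : ∀ᶠ n in atTop, ‖e n‖ < 1 :=
    he.norm.eventually_lt_const (by norm_num)
  have hlow : ∀ᶠ n in atTop, c ≤ ‖r n‖ := by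
    filter_upwards [he', hre] with n h1 h2
    have h3 : (e n * r n).re ≤ ‖e n‖ * ‖r n‖ := by
      rw [← norm_mul]; exact Complex.re_le_norm _
    nlinarith [norm_nonneg (r n)]
  set K := |a| + 1 + (|b| + 1) / c with hK
  have hup : ∀ᶠ n in atTop, ‖r n‖ ≤ K := by
    have : ∀ᶠ n in atTop, ‖r (n + 1)‖ ≤ K := by
      filter_upwards [hA', hB', hlow, hr] with n h1 h2 h3 h4
      rw [h4]
      refine (norm_add_le _ _).trans ?_
      rw [norm_div]
      exact add_le_add h1.le (div_le_div₀ (by positivity) h2.le hc h3)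
    -- An eventual property is a limit along a principal filter, which makes the index shift
    -- available.
    exact (tendsto_add_atTop_iff_nat (f := fun n => ‖r n‖) (l := 𝓟 (Iic K)) 1).1
      (tendsto_principal.2 this) |> tendsto_principal.1
  have hKpos : 0 < K := by positivity
  have he2 : ∀ᶠ n in atTop, ‖2 * e n - 1‖ < c / K := by
    have : Tendsto (fun n => 2 * e n - 1) atTop (𝓝 0) := by
      have := (he.const_mul 2).sub_const 1
      simpa using this
    have := this.norm
    rw [norm_zero] at this
    exact this.eventually_lt_const (by positivity)
  refine ⟨K, ?_⟩
  filter_upwards [hup, he2, hre] with n h1 h2 h3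
  refine ⟨h1, ?_⟩
  -- The first term has real part at least 2c and, since 2e → 1 and r is bounded, the second costs
  -- at most c.
  have h4 : r n = 2 * (e n * r n) - (2 * e n - 1) * r n := by ring
  have h5 : ((2 * e n - 1) * r n).re ≤ c := by
    refine (Complex.re_le_norm _).trans ?_
    rw [norm_mul]
    calc _ ≤ c / K * K := by gcongr
      _ = c := by field_simp
  rw [h4, Complex.sub_re]
  have : (2 * (e n * r n)).re = 2 * (e n * r n).re := by simp
  linarith

open Asymptotics in
/-- Second order asymptotics of `r (n + 1) = A n + B n / r n`, where the limit recursion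
`r = 1 - b + b / r` has the fixed points `1` and `-b`. -/
lemma exists_ratio_expansion {r A B e : ℕ → ℂ} {α β : ℂ} {b c : ℝ} (hb : 0 < b) (hb1 : b ≤ 1 / 2)
    (hc : 0 < c)
    (hA : (fun n => A n - ((1 - b : ℝ) : ℂ) - α * (((n : ℝ) + 1)⁻¹ : ℝ))
      =O[atTop] fun n : ℕ => (((n : ℝ) + 1)⁻¹) ^ 2)
    (hB : (fun n => B n - (b : ℂ) - β * (((n : ℝ) + 1)⁻¹ : ℝ))
      =O[atTop] fun n : ℕ => (((n : ℝ) + 1)⁻¹) ^ 2)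
    (he : Tendsto e atTop (𝓝 (1 / 2)))
    (hr : ∀ᶠ n in atTop, r (n + 1) = A n + B n / r n)
    (hre : ∀ᶠ n in atTop, c ≤ (e n * r n).re) :
    ∃ ρ : ℂ, (fun n => r n - 1 - ρ * (((n : ℝ) + 1)⁻¹ : ℝ))
      =O[atTop] fun n : ℕ => (((n : ℝ) + 1)⁻¹) ^ 2 := by
  set t : ℕ → ℝ := fun n => ((n : ℝ) + 1)⁻¹ with ht
  have ht0 : Tendsto t atTop (𝓝 0) := tendsto_inv_natCast_add_one
  have htpos : ∀ n, 0 < t n := fun n => by simp only [ht]; positivity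
  have ht1 : ∀ n, t n ≤ 1 := fun n => by
    simp only [ht]; exact inv_le_one_of_one_le₀ (by linarith [Nat.cast_nonneg (α := ℝ) n])
  have htO : (fun n => (t n : ℂ)) =O[atTop] t := by
    refine IsBigO.of_bound 1 (Eventually.of_forall fun n => by simp)
  have ht2 : (fun n => (t n) ^ 2) =O[atTop] t := by
    refine IsBigO.of_bound 1 (Eventually.of_forall fun n => ?_)
    rw [Real.norm_of_nonneg (by positivity), Real.norm_of_nonneg (htpos n).le]
    nlinarith [htpos n, ht1 n]
  have hA1 : (fun n => A n - ((1 - b : ℝ) : ℂ)) =O[atTop] t := by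
    have := (hA.trans ht2).add (htO.const_mul_left α)
    exact this.congr_left fun n => by ring
  have hB1 : (fun n => B n - (b : ℂ)) =O[atTop] t := by
    have := (hB.trans ht2).add (htO.const_mul_left β)
    exact this.congr_left fun n => by ring
  have hA0 : Tendsto A atTop (𝓝 ((1 - b : ℝ) : ℂ)) := by
    simpa using (hA1.trans_tendsto ht0).add_const ((1 - b : ℝ) : ℂ)
  have hB0 : Tendsto B atTop (𝓝 (b : ℂ)) := by
    simpa using (hB1.trans_tendsto ht0).add_const (b : ℂ)
  obtain ⟨K, hK⟩ := eventually_bounds_of_half_plane hc hA0 hB0 he hr hre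
  have hrinv : (fun n => (r n)⁻¹) =O[atTop] fun _ => (1 : ℝ) := by
    refine IsBigO.of_bound c⁻¹ ?_
    filter_upwards [hK] with n hn
    rw [norm_inv, norm_one, mul_one]
    exact inv_anti₀ hc (hn.2.trans (Complex.re_le_norm _))
  have hr0 : ∀ᶠ n in atTop, r n ≠ 0 := by
    filter_upwards [hK] with n hn h0
    rw [h0] at hn; simp at hn; linarith
  have hη : (fun n => A n - ((1 - b : ℝ) : ℂ) + (B n - b) * (r n)⁻¹) =O[atTop] t := by
    refine hA1.add ?_
    simpa using hB1.mul hrinv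
  -- first order
  have hu : (fun n => (r n - 1) / (r n + b)) =O[atTop] t := by
    obtain ⟨C, hC⟩ := hη.bound
    have := isBigO_inv_pow_of_contraction (x := fun n => (r n - 1) / (r n + b)) (q := b)
      (C := C * (1 + b) / b) hb.le (by linarith) 1 ?_
    · simpa using this
    have hK1 := (tendsto_add_atTop_nat 1).eventually hK
    filter_upwards [hK, hK1, hC, hr, hr0] with n h1 h2 h3 h4 h5
    set η := A n - ((1 - b : ℝ) : ℂ) + (B n - b) * (r n)⁻¹ with hηd
    have e1 : r (n + 1) = (1 - b) + b / r n + η := by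
      rw [h4, hηd]; push_cast; field_simp; ring
    have n1 : r n + b ≠ 0 := by
      intro h; have := congrArg Complex.re h; simp at this; linarith [h1.2]
    have n2 : r (n + 1) + b ≠ 0 := by
      intro h; have := congrArg Complex.re h; simp at this; linarith [h2.2]
    -- The Möbius coordinate sends the fixed points 1 and -b to 0 and ∞, so the unperturbed map
    -- becomes multiplication by -b.
    have key : (r (n + 1) - 1) / (r (n + 1) + b)
        = -(b * ((r n - 1) / (r n + b))) + η * (1 + b) / ((r (n + 1) + b) * ((r n + b) / r n)) := by
      have e2 : r (n + 1) + b = 1 + (b : ℂ) * (r n)⁻¹ + η := by rw [e1]; ring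
      have e3 : r (n + 1) - 1 = (b : ℂ) * (r n)⁻¹ - b + η := by rw [e1]; ring
      have e4 : (r n + b) / r n = 1 + (b : ℂ) * (r n)⁻¹ := by field_simp
      have e5 : (r n - 1) / (r n + b) = (1 - (r n)⁻¹) / (1 + (b : ℂ) * (r n)⁻¹) := by
        rw [← e4]; field_simp
      have n5 : 1 + (b : ℂ) * (r n)⁻¹ ≠ 0 := by rw [← e4]; exact div_ne_zero n1 h5
      rw [e2] at n2
      rw [e2, e3, e4, e5]
      generalize (r n)⁻¹ = s at *
      rw [← sub_eq_zero]
      have : ∀ X Y : ℂ, X ≠ 0 → Y ≠ 0 → Y = X + η →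
          (b * s - b + η) / Y - (-(b * ((1 - s) / X)) + η * (1 + b) / (Y * X))
            = ((b * s - b + η) * X + b * (1 - s) * Y - η * (1 + b)) / (X * Y) := by
        intro X Y hX hY _
        field_simp
        ring
      rw [this _ _ n5 n2 rfl, div_eq_zero_iff]
      left
      ring
    have b1 : b ≤ ‖r (n + 1) + b‖ := by
      refine le_trans ?_ (Complex.re_le_norm _)
      simp; linarith [h2.2]
    -- Adding b > 0 to a number with positive real part increases its modulus.
    have b2 : 1 ≤ ‖(r n + b) / r n‖ := by
      rw [norm_div, one_le_div (norm_pos_iff.2 h5), Complex.norm_def, Complex.norm_def]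
      apply Real.sqrt_le_sqrt
      simp [Complex.normSq_apply]
      nlinarith [h1.2]
    rw [key]
    refine (norm_add_le _ _).trans ?_
    rw [norm_neg, norm_mul (b : ℂ), Complex.norm_real, Real.norm_of_nonneg hb.le, pow_one,
      norm_div (η * _), norm_mul, norm_mul]
    have b3 : ‖(1 : ℂ) + b‖ = 1 + b := by
      rw [show (1 : ℂ) + b = ((1 + b : ℝ) : ℂ) by push_cast; rfl, Complex.norm_real,
        Real.norm_of_nonneg (by linarith)]
    rw [b3]
    have b4 : ‖η‖ ≤ C * t n := by rwa [Real.norm_of_nonneg (htpos n).le] at h3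
    have b5 : b ≤ ‖r (n + 1) + b‖ * ‖(r n + b) / r n‖ := by nlinarith
    gcongr
    calc _ ≤ C * t n * (1 + b) / b := by
          have : 0 ≤ C * t n := (norm_nonneg _).trans b4
          gcongr
      _ = _ := by simp only [ht]; ring
  have hr1 : (fun n => r n - 1) =O[atTop] t := by
    have h1 : (fun n => r n + b) =O[atTop] fun _ => (1 : ℝ) := by
      refine IsBigO.of_bound (K + b) ?_
      filter_upwards [hK] with n hn
      rw [norm_one, mul_one]
      refine (norm_add_le _ _).trans ?_
      rw [Complex.norm_real, Real.norm_of_nonneg hb.le]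
      linarith [hn.1]
    have h2 := hu.mul h1
    refine (h2.congr' ?_ (Eventually.of_forall fun n => by simp))
    filter_upwards [hK] with n hn
    have n1 : r n + b ≠ 0 := by
      intro h; have := congrArg Complex.re h; simp at this; linarith [hn.2]
    field_simp
  -- second order
  set ρ : ℂ := (α + β) / (1 + b) with hρ
  have hb1' : (1 : ℂ) + b ≠ 0 := by
    intro h; have := congrArg Complex.re h; simp at this; linarith
  have hρ' : ρ * (1 + b) = α + β := by rw [hρ]; field_simp
  refine ⟨ρ, ?_⟩
  have hts : (fun n => ((t n - t (n + 1) : ℝ) : ℂ)) =O[atTop] fun n => (t n) ^ 2 := by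
    refine IsBigO.of_bound 1 (Eventually.of_forall fun n => ?_)
    rw [Complex.norm_real, one_mul, Real.norm_of_nonneg (sq_nonneg (t n)), Real.norm_eq_abs]
    have : t n - t (n + 1) = t n * t (n + 1) := by
      simp only [ht]; push_cast
      have h1 : (n : ℝ) + 1 ≠ 0 := by positivity
      have h2 : (n : ℝ) + 1 + 1 ≠ 0 := by positivity
      field_simp
      ring
    rw [this, abs_of_nonneg (mul_nonneg (htpos _).le (htpos _).le), sq]
    have : t (n + 1) ≤ t n := by
      simp only [ht]; push_cast
      apply inv_anti₀ (by positivity) (by linarith)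
    exact mul_le_mul_of_nonneg_left this (htpos n).le
  -- The remainder x = r - 1 - ρt satisfies x' = -b x + O(t²), by 1/r = 1 - (r-1) + (r-1)²/r and by
  -- t n - t (n+1) = O(t²).
  have hsum : (fun n => r (n + 1) - 1 - ρ * t (n + 1) + b * (r n - 1 - ρ * t n))
      =O[atTop] fun n => (t n) ^ 2 := by
    have m1 : (fun n => (B n - b - β * t n) * (r n)⁻¹) =O[atTop] fun n => (t n) ^ 2 :=
      (hB.mul hrinv).congr_right fun n => mul_one _
    have m2 : (fun n => (b : ℂ) * ((r n - 1) * (r n - 1) * (r n)⁻¹)) =O[atTop]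
        fun n => (t n) ^ 2 := by
      have := ((hr1.mul hr1).mul hrinv).const_mul_left (b : ℂ)
      simpa [sq] using this
    have m3 : (fun n => β * (t n * (r n - 1) * (r n)⁻¹)) =O[atTop] fun n => (t n) ^ 2 := by
      have := ((htO.mul hr1).mul hrinv).const_mul_left β
      simpa [sq] using this
    have m4 := hts.const_mul_left ρ
    have := ((hA.add m1).add m2).sub m3 |>.add m4
    refine this.congr' ?_ EventuallyEq.rfl
    filter_upwards [hr, hr0] with n h1 h2
    have htn : ((n : ℝ) + 1)⁻¹ = t n := rfl
    rw [h1, htn]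
    clear_value t ρ
    push_cast
    have hinv : B n / r n = B n * (r n)⁻¹ := div_eq_mul_inv _ _
    have hrr : r n * (r n)⁻¹ = 1 := mul_inv_cancel₀ h2
    rw [hinv]
    linear_combination (t n : ℂ) * hρ' + (b * (r n - 2) - β * t n) * hrr
  obtain ⟨C, hC⟩ := hsum.bound
  refine isBigO_inv_pow_of_contraction (q := b) (C := C) hb.le (by linarith) 2 ?_
  filter_upwards [hC] with n hn
  rw [Real.norm_of_nonneg (by positivity)] at hn
  have : r (n + 1) - 1 - ρ * t (n + 1)
    = (r (n + 1) - 1 - ρ * t (n + 1) + b * (r n - 1 - ρ * t n)) - b * (r n - 1 - ρ * t n) := by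
    ring
  rw [show (((((n + 1 : ℕ) : ℝ) + 1)⁻¹ : ℝ) : ℂ) = (t (n + 1) : ℂ) from rfl, this]
  refine (norm_sub_le _ _).trans ?_
  rw [norm_mul, Complex.norm_real, Real.norm_of_nonneg hb.le, add_comm]
  gcongr

/-! ### One step of the half-plane invariant. -/

/-- Inversion maps the half-plane Re s ≥ p into the disc with centre and radius 1/(2p). Hence β/s
differs from β/(2p) by at most ‖β‖/(2p), and only the defect ‖β‖ - Re β is lost. -/
lemma re_div_ge_of_le_re {s β : ℂ} {p κ : ℝ} (hp : 0 < p) (hs : p ≤ s.re)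
    (hβ : ‖β‖ - β.re ≤ κ) : -(κ / (2 * p)) ≤ (β / s).re := by
  have hs0 : s ≠ 0 := by rintro rfl; simp at hs; linarith
  have h1 : ‖1 / s - 1 / (2 * p : ℝ)‖ ≤ 1 / (2 * p) := by
    have h2 : (1 : ℂ) / s - 1 / (2 * p : ℝ) = ((2 * p : ℝ) - s) / ((2 * p : ℝ) * s) := by
      have : ((2 * p : ℝ) : ℂ) ≠ 0 := by
        rw [Complex.ofReal_ne_zero]; positivity
      field_simp
    have h3 : ‖((2 * p : ℝ) : ℂ) - s‖ ≤ ‖s‖ := by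
      rw [Complex.norm_def, Complex.norm_def]
      apply Real.sqrt_le_sqrt
      simp only [Complex.normSq_apply, Complex.sub_re, Complex.sub_im, Complex.ofReal_re,
        Complex.ofReal_im]
      nlinarith
    rw [h2, norm_div, norm_mul, Complex.norm_real, Real.norm_of_nonneg (by positivity),
      div_le_div_iff₀ (by have := norm_pos_iff.2 hs0; positivity) (by positivity)]
    nlinarith
  have h2 : β / s = β * ((1 / (2 * p) : ℝ) : ℂ) + β * (1 / s - 1 / (2 * p : ℝ)) := by
    push_cast; ring
  have h3 : -(‖β‖ * (1 / (2 * p))) ≤ (β * (1 / s - 1 / (2 * p : ℝ))).re := by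
    have := Complex.abs_re_le_norm (β * (1 / s - 1 / (2 * p : ℝ)))
    rw [norm_mul] at this
    have h4 := mul_le_mul_of_nonneg_left h1 (norm_nonneg β)
    linarith [abs_le.1 (this.trans h4)]
  rw [h2, Complex.add_re, Complex.re_mul_ofReal]
  have h5 : (‖β‖ - β.re) * (1 / (2 * p)) ≤ κ * (1 / (2 * p)) := by gcongr
  have h6 : κ / (2 * p) = κ * (1 / (2 * p)) := by ring
  rw [h6]
  linarith

/-- The real part of 1 - c/v is nonnegative, so the defect is at most the modulus of the imaginary
part, c|Im v|/|v|², and 2 |Im v| Re v ≤ |v|². -/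
lemma norm_sub_re_one_sub_div_le {v : ℂ} {c q : ℝ} (hc : 0 ≤ c) (hq : 0 < q) (hcq : c ≤ q)
    (hv : q ≤ v.re) : ‖1 - (c : ℂ) / v‖ - (1 - (c : ℂ) / v).re ≤ c / (2 * q) := by
  have hpos : 0 < Complex.normSq v := by
    rw [Complex.normSq_apply]; nlinarith [mul_self_nonneg v.im]
  have hre : ((c : ℂ) / v).re = c * v.re / Complex.normSq v := by
    simp [Complex.div_re]
  have him : ((c : ℂ) / v).im = -(c * v.im / Complex.normSq v) := by
    simp [Complex.div_im]
  have h1 : 0 ≤ (1 - (c : ℂ) / v).re := by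
    rw [Complex.sub_re, hre, Complex.one_re, sub_nonneg, div_le_one hpos, Complex.normSq_apply]
    nlinarith [mul_self_nonneg v.im]
  have h2 : |(1 - (c : ℂ) / v).im| ≤ c / (2 * q) := by
    rw [Complex.sub_im, him, Complex.one_im, zero_sub, neg_neg, abs_div, abs_mul,
      abs_of_nonneg hc, abs_of_pos hpos, div_le_div_iff₀ hpos (by positivity),
      Complex.normSq_apply, mul_assoc]
    apply mul_le_mul_of_nonneg_left _ hc
    have h3 : |v.im| * (2 * q) ≤ |v.im| * (2 * v.re) := by gcongr
    nlinarith [sq_nonneg (v.re - |v.im|), sq_abs v.im]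
  have h3 := Complex.norm_le_abs_re_add_abs_im (1 - (c : ℂ) / v)
  rw [abs_of_nonneg h1] at h3
  linarith

/-- Re (c/v) = c Re v/|v|² ≤ C/Re v ≤ C/q. The separate bound C ≥ 0 also covers negative c. -/
lemma re_add_sub_div_ge {v : ℂ} {q e c C : ℝ} (hq : 0 < q) (hv : q ≤ v.re) (hcC : c ≤ C)
    (hC : 0 ≤ C) : q + e - C / q ≤ (v + e - (c : ℂ) / v).re := by
  have hpos : 0 < Complex.normSq v := by
    rw [Complex.normSq_apply]; nlinarith [mul_self_nonneg v.im]
  have hre : ((c : ℂ) / v).re = c * v.re / Complex.normSq v := by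
    simp [Complex.div_re]
  have h1 : c * v.re / Complex.normSq v ≤ C / q := by
    rw [div_le_div_iff₀ hpos hq, Complex.normSq_apply]
    have h2 : c * v.re * q ≤ C * v.re * q := by gcongr; linarith
    have h3 : C * v.re * q ≤ C * v.re * v.re := by
      apply mul_le_mul_of_nonneg_left hv
      apply mul_nonneg hC; linarith
    nlinarith [mul_nonneg hC (mul_self_nonneg v.im)]
  simp only [Complex.sub_re, Complex.add_re, Complex.ofReal_re, hre]
  linarith

/-- One step of the half-plane invariant for a three-term recurrence. -/
lemma half_plane_step {a a1 a2 N M w v β : ℂ} {α α' D p p' κ q e c C : ℝ}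
    (hD : 0 < D) (hα : 0 < α) (hp : 0 < p) (hq : 0 < q) (hqv : q ≤ v.re)
    (hrec : α' * D * a2 = N * a1 + M * a) (hN : N = D * (v * (v + e) - c))
    (hM : M = β * (w * v)) (hβ : ‖β‖ - β.re ≤ κ) (hc : c ≤ C) (hC : 0 ≤ C)
    (hs : p ≤ (α * (a1 / a) / w).re) (hnum : p' + α / D * (κ / (2 * p)) ≤ q + e - C / q) :
    a1 ≠ 0 ∧ p' ≤ (α' * (a2 / a1) / v).re := by
  have ha1 : a1 ≠ 0 := by rintro rfl; simp at hs; linarith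
  have hv : v ≠ 0 := by rintro rfl; simp at hqv; linarith
  refine ⟨ha1, ?_⟩
  have hDc : (D : ℂ) ≠ 0 := by exact_mod_cast hD.ne'
  have hαc : (α : ℂ) ≠ 0 := by exact_mod_cast hα.ne'
  -- Dividing the recurrence by D · a1 · v cancels v from the coefficient of a; what remains there
  -- is β w a/a1, that is, α β/s for the old normalised ratio s.
  have key : (α' : ℂ) * (a2 / a1) / v
      = (v + e - (c : ℂ) / v) + ((α / D : ℝ) : ℂ) * (β / (α * (a1 / a) / w)) := by
    have h1 : (α' : ℂ) * a2 = (N * a1 + M * a) / D := by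
      rw [← hrec]; field_simp
    rw [mul_div_assoc', h1, hN, hM]
    push_cast
    field_simp
  have h1 := re_add_sub_div_ge (e := e) hq hqv hc hC
  have h2 := re_div_ge_of_le_re hp hs hβ
  rw [key, Complex.add_re, Complex.re_ofReal_mul]
  have h3 := mul_le_mul_of_nonneg_left h2 (div_pos hα hD).le
  linarith

/-- First step of the half-plane invariant, from the two-term relation. -/
lemma half_plane_start {a1 a2 N v : ℂ} {α' D p' q e c C : ℝ}
    (hD : 0 < D) (hq : 0 < q) (hqv : q ≤ v.re) (ha1 : a1 ≠ 0)
    (hrec : α' * D * a2 = N * a1) (hN : N = D * (v * (v + e) - c))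
    (hc : c ≤ C) (hC : 0 ≤ C) (hnum : p' ≤ q + e - C / q) :
    p' ≤ (α' * (a2 / a1) / v).re := by
  have hv : v ≠ 0 := by rintro rfl; simp at hqv; linarith
  have hDc : (D : ℂ) ≠ 0 := by exact_mod_cast hD.ne'
  have key : (α' : ℂ) * (a2 / a1) / v = v + e - (c : ℂ) / v := by
    have h1 : (α' : ℂ) * a2 = (N * a1) / D := by
      rw [← hrec]; field_simp
    rw [mul_div_assoc', h1, hN]
    field_simp
  rw [key]
  exact hnum.trans (re_add_sub_div_ge hq hqv hc hC)

/-- The half-plane invariant for the ratio `a (n + 1) / a n`. -/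
def InHalfPlane (a : ℕ → ℂ) (γ : ℝ) (κ : ℂ) (p : ℝ) (n : ℕ) : Prop :=
  a n ≠ 0 ∧ p ≤ (((4 * (n + 1) * (n + γ) : ℝ) : ℂ) * (a (n + 1) / a n) / (2 * n + κ)).re

lemma tendsto_natCast_add_div (γ : ℝ) (κ : ℂ) :
    Tendsto (fun n : ℕ => ((n : ℂ) + γ) / (2 * n + κ)) atTop (𝓝 (1 / 2)) := by
  have h0 : Tendsto (fun n : ℕ => (n : ℂ)⁻¹) atTop (𝓝 0) := tendsto_inv_atTop_nhds_zero_nat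
  have h1 : Tendsto (fun n : ℕ => (1 + (γ : ℂ) * (n : ℂ)⁻¹) / (2 + κ * (n : ℂ)⁻¹)) atTop
      (𝓝 ((1 + (γ : ℂ) * 0) / (2 + κ * 0))) :=
    ((h0.const_mul _).const_add _).div ((h0.const_mul _).const_add _) (by simp)
  simp only [mul_zero, add_zero] at h1
  refine h1.congr' ?_
  filter_upwards [eventually_gt_atTop 0] with n hn
  have : (n : ℂ) ≠ 0 := by exact_mod_cast hn.ne'
  rw [← mul_div_mul_left _ _ this]
  congr 1 <;> field_simp

/-- Reformulation of the half-plane invariant as used for the asymptotic analysis. -/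
lemma exists_half_plane_of_forall {a : ℕ → ℂ} {γ : ℝ} {κ : ℂ} {p : ℕ → ℝ} {n₀ : ℕ}
    (hp : ∀ n : ℕ, ((n : ℝ) + 1) / 2 ≤ p n) (h : ∀ n ≥ n₀, InHalfPlane a γ κ (p n) n) :
    (∀ᶠ n in atTop, a n ≠ 0) ∧ ∃ e : ℕ → ℂ, Tendsto e atTop (𝓝 (1 / 2)) ∧
      ∀ᶠ n in atTop, 1 / 8 ≤ (e n * (a (n + 1) / a n)).re := by
  refine ⟨?_, _, tendsto_natCast_add_div γ κ, ?_⟩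
  · filter_upwards [eventually_ge_atTop n₀] with n hn using (h n hn).1
  · filter_upwards [eventually_ge_atTop n₀] with n hn
    have h1 := (hp n).trans (h n hn).2
    have h2 : ((4 * (n + 1) * (n + γ) : ℝ) : ℂ) * (a (n + 1) / a n) / (2 * n + κ)
        = ((4 * (n + 1) : ℝ) : ℂ) * (((n : ℂ) + γ) / (2 * n + κ) * (a (n + 1) / a n)) := by
      push_cast; ring
    -- Dividing the lower bound (n+1)/2 by 4(n+1) yields 1/8.
    rw [h2, Complex.re_ofReal_mul] at h1
    have h3 : (0 : ℝ) < n + 1 := by positivity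
    nlinarith

/-- Induction scheme for the half-plane invariant. -/
lemma inHalfPlane_of_step {a : ℕ → ℂ} {γ : ℝ} {κ : ℂ} {p : ℕ → ℝ} {n₀ : ℕ}
    (h0 : InHalfPlane a γ κ (p n₀) n₀)
    (hstep : ∀ n ≥ n₀, InHalfPlane a γ κ (p n) n → InHalfPlane a γ κ (p (n + 1)) (n + 1)) :
    ∀ n ≥ n₀, InHalfPlane a γ κ (p n) n := fun n hn => by
  induction n, hn using Nat.le_induction with
  | base => exact h0
  | succ n hn ih => exact hstep n hn ih

/-- The recurrence for the coefficients of the normalised power series solution at `0` of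
`h'' + (γ / x + δ / (x - 1) + ε / (D + x)) h' + (q₀ + q₁ x) / (4 x (x - 1) (D + x)) h = 0`. -/
structure IsHeunSeq (D γ : ℝ) (δ ε q₀ q₁ : ℂ) (a : ℕ → ℂ) : Prop where
  zero : a 0 = 1
  one : ((4 * D * γ : ℝ) : ℂ) * a 1 = q₀ * a 0
  step (n : ℕ) : ((4 * (n + 2) * (n + 1 + γ) : ℝ) : ℂ) * D * a (n + 2)
    = (4 * (D - 1) * n * (n + 1) + (4 * γ * (D - 1) + 4 * δ * D - 4 * ε) * (n + 1) + q₀) * a (n + 1)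
      + (4 * n * (n - 1) + (4 * γ + 4 * δ + 4 * ε) * n + q₁) * a n

namespace IsHeunSeq

variable {D γ : ℝ} {δ ε q₀ q₁ : ℂ} {a : ℕ → ℂ}

/-- This is `half_plane_step` with w = 2n+κ and v = 2n+2+κ. The v of one index is the w of the next,
which lets the steps be chained. -/
lemma inHalfPlane_succ (ha : IsHeunSeq D γ δ ε q₀ q₁ a) {κ β : ℂ} {n : ℕ} {p p' k q e c C : ℝ}
    (hD : 0 < D) (hγ : 0 < γ) (hp : 0 < p) (hq : 0 < q) (hqv : q ≤ (2 * n + 2 + κ).re)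
    (hN : 4 * (D - 1) * n * (n + 1) + (4 * γ * (D - 1) + 4 * δ * D - 4 * ε) * (n + 1) + q₀
      = D * ((2 * n + 2 + κ) * (2 * n + 2 + κ + e) - c))
    (hM : 4 * n * (n - 1) + (4 * γ + 4 * δ + 4 * ε) * n + q₁
      = β * ((2 * n + κ) * (2 * n + 2 + κ)))
    (hβ : ‖β‖ - β.re ≤ k) (hc : c ≤ C) (hC : 0 ≤ C)
    (hnum : p' + 4 * (n + 1) * (n + γ) / D * (k / (2 * p)) ≤ q + e - C / q)
    (h : InHalfPlane a γ κ p n) : InHalfPlane a γ κ p' (n + 1) := by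
  have hα : (0 : ℝ) < 4 * (n + 1) * (n + γ) := by positivity
  have := half_plane_step hD hα hp hq hqv (ha.step n) hN hM hβ hc hC h.2 hnum
  refine ⟨this.1, this.2.trans_eq ?_⟩
  push_cast
  ring_nf

end IsHeunSeq

/-! ### The half-plane invariant in the four families. -/

/-- Brings a coefficient that factors as w(v - c) into the form β w v required by `half_plane_step`,
with β = 1 - c/v. -/
lemma one_sub_div_mul_mul {v : ℂ} (c w : ℂ) (hv : v ≠ 0) :
    (1 - c / v) * (w * v) = w * (v - c) := by
  field_simp

/-- Write E = z² + 5z + t, so that (z+2)(z+3) = E + (6-t). Up to a positive factor, the real part is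
|E|² Re(z+4) + (6-t) Re(E(z+4)). With z = x + iy, its negative contribution -(6-t)(3x+9)y² is
absorbed by the term y²(2x+5)²(x+4) of the first summand. -/
lemma re_quotient_nonneg {z : ℂ} {t : ℝ} (hz : 0 ≤ z.re) (ht : 0 ≤ t) (ht2 : t ≤ 2) :
    0 ≤ ((z + 2) * (z + 3) / ((z ^ 2 + 5 * z + (t : ℂ)) * (z + 4))).re := by
  obtain ⟨x, y⟩ := z
  simp only at hz
  rw [Complex.div_re, ← add_div]
  apply div_nonneg _ (Complex.normSq_nonneg _)
  simp [pow_two]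
  have hy := mul_self_nonneg y
  have h1 : 0 ≤ (2 * x + 5) ^ 2 * (x + 4) - 54 - 18 * x := by ring_nf; nlinarith [pow_nonneg hz 3]
  have key : 0 ≤ (x * x - y * y + 5 * x + t) ^ 2 * (x + 4)
      + y * y * ((2 * x + 5) ^ 2 * (x + 4) - 54 - 18 * x)
      + t * (y * y) * (3 * x + 9) + (6 - t) * (x ^ 3 + 9 * x ^ 2 + (20 + t) * x + 4 * t) := by
    have : 0 ≤ 6 - t := by linarith
    positivity
  linarith

/-- The first exceptional family: `l = 1`, `m = d - 1`, with `D = d - 2`. -/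
lemma IsHeunSeq.inHalfPlane_of_l_one_of_m_max {D : ℝ} {z : ℂ} {a : ℕ → ℂ} (hD : 2 ≤ D)
    (hz : 0 ≤ z.re)
    (ha : IsHeunSeq D (D / 2 + 3) ((2 * z + 1 - D) / 2) 0 (D * z ^ 2 + 5 * D * z + 2 * D - 4)
      ((z + 2) * (z + 3)) a) :
    ∃ n₀ : ℕ, ∀ n ≥ n₀, InHalfPlane a (D / 2 + 3) (z + 2) (((n : ℝ) + 1) / 2) n := by
  have hDc : (D : ℂ) ≠ 0 := by exact_mod_cast (by linarith : D ≠ 0)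
  have hC : ∀ n : ℕ, 6 + 2 * n + 4 * ((n : ℝ) + 2) ^ 2 / D ≤ 6 + 2 * n + 2 * ((n : ℝ) + 2) ^ 2 := by
    intro n
    have : 4 * ((n : ℝ) + 2) ^ 2 / D ≤ 2 * ((n : ℝ) + 2) ^ 2 := by
      rw [div_le_iff₀ (by linarith)]; nlinarith [sq_nonneg ((n : ℝ) + 2)]
    linarith
  have hqv : ∀ n : ℕ, (2 * n + 4 : ℝ) ≤ (2 * n + 2 + (z + 2) : ℂ).re := by
    intro n; simp; linarith
  -- With κ = z+2 and e = 1, the product v(v+e) absorbs all dependence on z; the correction c is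
  -- real.
  have hNid : ∀ n : ℕ, 4 * ((D : ℂ) - 1) * n * (n + 1) + (4 * ((D / 2 + 3 : ℝ) : ℂ) * (D - 1)
      + 4 * ((2 * z + 1 - D) / 2) * D - 4 * 0) * (n + 1) + (D * z ^ 2 + 5 * D * z + 2 * D - 4)
      = D * ((2 * n + 2 + (z + 2)) * (2 * n + 2 + (z + 2) + (1 : ℝ))
        - (6 + 2 * n + 4 * ((n : ℝ) + 2) ^ 2 / D : ℝ)) := by
    intro n; push_cast; field_simp; ring
  have hv0 : ∀ n : ℕ, (2 * n + 2 + (z + 2) : ℂ) ≠ 0 := by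
    intro n h0
    have := hqv n
    rw [h0, Complex.zero_re] at this
    have : (0 : ℝ) ≤ n := Nat.cast_nonneg n
    linarith
  have hstep : ∀ n : ℕ, n ≥ 1 → InHalfPlane a (D / 2 + 3) (z + 2) (((n : ℝ) + 1) / 2) n →
      InHalfPlane a (D / 2 + 3) (z + 2) ((((n + 1 : ℕ) : ℝ) + 1) / 2) (n + 1) := by
    intro n hn h
    have hn' : (1 : ℝ) ≤ n := by exact_mod_cast hn
    refine ha.inHalfPlane_succ (β := 1 - ((1 : ℝ) : ℂ) / (2 * n + 2 + (z + 2))) (q := 2 * n + 4)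
      (e := 1) (by linarith) (by linarith) (by linarith) (by linarith) (hqv n) (hNid n) ?_
      (norm_sub_re_one_sub_div_le (q := 2 * n + 4) zero_le_one (by linarith) (by linarith) (hqv n))
      (hC n) (by positivity) ?_ h
    · rw [one_sub_div_mul_mul _ _ (hv0 n)]
      push_cast
      ring
    -- The left side decreases in D, so D = 2 is the worst case.
    · have h1 : 4 * ((n : ℝ) + 1) * (n + (D / 2 + 3)) / D ≤ 2 * (n + 1) * (n + 4) := by
        rw [div_le_iff₀ (by linarith)]
        nlinarith [mul_nonneg (show (0 : ℝ) ≤ (n + 1) * (n + 3) by positivity) (sub_nonneg.2 hD)]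
      have h2 : 4 * ((n : ℝ) + 1) * (n + (D / 2 + 3)) / D * (1 / (2 * (2 * n + 4))
          / (2 * ((n + 1) / 2))) ≤ 2 * (n + 1) * (n + 4) * (1 / (2 * (2 * n + 4))
          / (2 * ((n + 1) / 2))) := by gcongr
      have h3 : 2 * ((n : ℝ) + 1) * (n + 4) * (1 / (2 * (2 * n + 4)) / (2 * ((n + 1) / 2)))
          ≤ 5 / 6 := by
        have : (n : ℝ) + 1 ≠ 0 := by positivity
        rw [show 2 * ((n : ℝ) + 1) * (n + 4) * (1 / (2 * (2 * n + 4)) / (2 * ((n + 1) / 2)))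
          = (n + 4) / (2 * n + 4) by field_simp, div_le_iff₀ (by positivity)]
        linarith
      have h4 : (6 + 2 * n + 2 * ((n : ℝ) + 2) ^ 2) / (2 * n + 4) ≤ n + 10 / 3 := by
        rw [div_le_iff₀ (by positivity)]; nlinarith
      push_cast
      linarith
  set E : ℂ := z ^ 2 + 5 * z + ((2 - 4 / D : ℝ) : ℂ) with hE
  have hone : ((4 * (D / 2 + 3) : ℝ) : ℂ) * a 1 = E := by
    have := ha.one
    rw [ha.zero] at this
    have h2 : (D : ℂ) * (((4 * (D / 2 + 3) : ℝ) : ℂ) * a 1) = D * E := by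
      rw [hE]
      have h4 : (D : ℂ) * (4 / D) = 4 := by field_simp
      push_cast at this ⊢
      linear_combination this + h4
    exact mul_left_cancel₀ hDc h2
  -- The coefficient a 1 can vanish, for instance at D = 2, z = 0. The recurrence for a 3 then has
  -- only one term, and the induction starts at index 2.
  by_cases ha1 : a 1 = 0
  · refine ⟨2, inHalfPlane_of_step (p := fun n => ((n : ℝ) + 1) / 2) ?_
      fun n hn => hstep n (by omega)⟩
    constructor
    · intro h2
      have := ha.step 0
      rw [ha.zero, ha1, zero_add, h2] at this
      norm_num at this
      rcases this with h | h <;> · have := congrArg Complex.re h; simp at this; linarith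
    · have h1 := ha.step 1
      have h10 : ∀ X : ℂ, X * a 1 = 0 := fun X => by rw [ha1, mul_zero]
      rw [h10, add_zero] at h1
      have h2ne : a 2 ≠ 0 := by
        intro h2
        have := ha.step 0
        rw [ha.zero, ha1, zero_add, h2] at this
        norm_num at this
        rcases this with h | h <;> · have := congrArg Complex.re h; simp at this; linarith
      have := half_plane_start (p' := 3 / 2) (by linarith) (by norm_num) (hqv 1) h2ne h1 (hNid 1)
        (hC 1) (by norm_num) (by norm_num)
      norm_num at this ⊢
      convert this using 5
  · refine ⟨1, inHalfPlane_of_step (p := fun n => ((n : ℝ) + 1) / 2) ⟨ha1, ?_⟩ hstep⟩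
    have h0 := ha.step 0
    rw [ha.zero, zero_add] at h0
    set v : ℂ := 2 * (0 : ℕ) + 2 + (z + 2) with hv
    have hv' : v ≠ 0 := hv0 0
    have hveq : v = z + 4 := by rw [hv]; push_cast; ring
    have hE0 : E ≠ 0 := by
      rw [← hone]
      refine mul_ne_zero ?_ ha1
      rw [Complex.ofReal_ne_zero]; positivity
    have hγ0 : ((4 * (D / 2 + 3) : ℝ) : ℂ) ≠ 0 := by
      rw [Complex.ofReal_ne_zero]; positivity
    have ha1' : a 1 = E / ((4 * (D / 2 + 3) : ℝ) : ℂ) := by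
      rw [← hone, mul_div_cancel_left₀ _ hγ0]
    obtain ⟨c, hc⟩ : ∃ c : ℝ, c = 6 + 2 * (0 : ℕ) + 4 * (((0 : ℕ) : ℝ) + 2) ^ 2 / D := ⟨_, rfl⟩
    -- The normalised ratio at index 0 is E/(z+2), which has no uniform positive lower bound (D = 2,
    -- z → 0). The term β/s is therefore computed exactly, and `re_quotient_nonneg` shows that it
    -- does no harm.
    have key : ((4 * ((1 : ℕ) + 1) * ((1 : ℕ) + (D / 2 + 3)) : ℝ) : ℂ) * (a (1 + 1) / a 1)
          / (2 * (1 : ℕ) + (z + 2))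
        = (v + (1 : ℝ) - (c : ℂ) / v)
          + ((4 * (D / 2 + 3) / D : ℝ) : ℂ) * ((z + 2) * (z + 3) / (E * (z + 4))) := by
      rw [hNid 0, ← hv, ← hc] at h0
      have e1 : ((4 * ((1 : ℕ) + 1) * ((1 : ℕ) + (D / 2 + 3)) : ℝ) : ℂ) * a (1 + 1)
          = (v * (v + (1 : ℝ)) - (c : ℂ)) * a 1
            + (z + 2) * (z + 3) / D := by
        field_simp
        push_cast at h0 ⊢
        linear_combination h0
      have e2 : (2 * (1 : ℕ) + (z + 2) : ℂ) = v := by rw [hveq]; push_cast; ring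
      rw [e2, mul_div_assoc', e1, ← hveq]
      rw [add_div, mul_div_cancel_right₀ _ ha1, ha1', Complex.ofReal_div]
      field_simp
    rw [key, Complex.add_re, Complex.re_ofReal_mul]
    have t1 := re_add_sub_div_ge (e := 1) (by norm_num) (hqv 0) (hC 0) (by norm_num)
    have t2 := re_quotient_nonneg (t := 2 - 4 / D) hz
      (by rw [sub_nonneg, div_le_iff₀ (by linarith)]; linarith)
      (by linarith [div_pos (show (0 : ℝ) < 4 by norm_num) (show (0 : ℝ) < D by linarith)])
    have t3 : 0 ≤ 4 * (D / 2 + 3) / D := by positivity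
    rw [← hE] at t2
    rw [← hv, ← hc] at t1
    have t4 := mul_nonneg t3 t2
    norm_num at t1 t4 ⊢
    linarith

/-- The second exceptional family: `l = 1`, `m = 1`, with `D = d - 2`. -/
lemma IsHeunSeq.inHalfPlane_of_l_one_of_m_one {D : ℝ} {z : ℂ} {a : ℕ → ℂ} (hD : 2 ≤ D)
    (hz : 0 ≤ z.re)
    (ha : IsHeunSeq D (D / 2 + 3) ((2 * z + 1 - D) / 2) 0 (D * z ^ 2 + 5 * D * z + 4 * D - 4)
      ((z + 1) * (z + 4)) a) :
    ∀ n : ℕ, n ≥ 1 → InHalfPlane a (D / 2 + 3) (z + 2) (((n : ℝ) + 1) / 2) n := by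
  have hDc : (D : ℂ) ≠ 0 := by exact_mod_cast (by linarith : D ≠ 0)
  have hC : ∀ n : ℕ, 4 + 2 * n + 4 * ((n : ℝ) + 2) ^ 2 / D ≤ 4 + 2 * n + 2 * ((n : ℝ) + 2) ^ 2 := by
    intro n
    have : 4 * ((n : ℝ) + 2) ^ 2 / D ≤ 2 * ((n : ℝ) + 2) ^ 2 := by
      rw [div_le_iff₀ (by linarith)]; nlinarith [sq_nonneg ((n : ℝ) + 2)]
    linarith
  have hqv : ∀ n : ℕ, (2 * n + 4 : ℝ) ≤ (2 * n + 2 + (z + 2) : ℂ).re := by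
    intro n; simp; linarith
  have hqw : ∀ n : ℕ, (2 * n + 2 : ℝ) ≤ (2 * n + (z + 2) : ℂ).re := by
    intro n; simp; linarith
  have hw0 : ∀ n : ℕ, (2 * n + (z + 2) : ℂ) ≠ 0 := by
    intro n h0
    have := hqw n
    rw [h0, Complex.zero_re] at this
    have : (0 : ℝ) ≤ n := Nat.cast_nonneg n
    linarith
  have hstep : ∀ (n : ℕ) (p p' : ℝ), 0 < p → p' + (n + 4) / (2 * (2 * p)) ≤ n + 2 →
      InHalfPlane a (D / 2 + 3) (z + 2) p n →
      InHalfPlane a (D / 2 + 3) (z + 2) p' (n + 1) := by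
    intro n p p' hp hpp' h
    -- Here the coefficient of a n is (w - 1) v, so the correction in β is 1/w rather than 1/v.
    refine ha.inHalfPlane_succ (β := 1 - ((1 : ℝ) : ℂ) / (2 * n + (z + 2))) (q := 2 * n + 4)
      (e := 1) (c := 4 + 2 * n + 4 * ((n : ℝ) + 2) ^ 2 / D) (by linarith) (by linarith) hp
      (by positivity) (hqv n) ?_ ?_
      (norm_sub_re_one_sub_div_le (q := 2 * n + 2) zero_le_one (by positivity)
        (by linarith [Nat.cast_nonneg (α := ℝ) n]) (hqw n))
      (hC n) (by positivity) ?_ h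
    · push_cast; field_simp; ring
    · rw [mul_comm (2 * (n : ℂ) + (z + 2)) _, one_sub_div_mul_mul _ _ (hw0 n)]
      push_cast
      ring
    · have h1 : 4 * ((n : ℝ) + 1) * (n + (D / 2 + 3)) / D ≤ 2 * (n + 1) * (n + 4) := by
        rw [div_le_iff₀ (by linarith)]
        nlinarith [mul_nonneg (show (0 : ℝ) ≤ (n + 1) * (n + 3) by positivity) (sub_nonneg.2 hD)]
      have h2 : 4 * ((n : ℝ) + 1) * (n + (D / 2 + 3)) / D * (1 / (2 * (2 * n + 2))
          / (2 * p)) ≤ 2 * (n + 1) * (n + 4) * (1 / (2 * (2 * n + 2)) / (2 * p)) := by gcongr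
      have h3 : 2 * ((n : ℝ) + 1) * (n + 4) * (1 / (2 * (2 * n + 2)) / (2 * p))
          = (n + 4) / (2 * (2 * p)) := by
        have : (n : ℝ) + 1 ≠ 0 := by positivity
        rw [show 2 * (2 * (n : ℝ) + 2) = 4 * (n + 1) by ring]
        field_simp
        ring
      have h4 : (4 + 2 * n + 2 * ((n : ℝ) + 2) ^ 2) / (2 * n + 4) = n + 3 := by
        rw [div_eq_iff (by positivity)]; ring
      linarith
  have h0 : InHalfPlane a (D / 2 + 3) (z + 2) 1 0 := by
    have h00 : a 0 ≠ 0 := by rw [ha.zero]; exact one_ne_zero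
    refine ⟨h00, ?_⟩
    have h1 := half_plane_start (a1 := a 0) (a2 := a 1) (α' := 4 * (D / 2 + 3)) (D := D)
      (N := D * z ^ 2 + 5 * D * z + 4 * D - 4) (v := z + 2) (p' := 1) (q := 2) (e := 1)
      (c := 2 + 4 / D) (C := 4) (by linarith) two_pos (by simp; linarith) h00
      (by rw [← ha.one]; push_cast; ring) (by push_cast; field_simp; ring)
      (by have : 4 / D ≤ 2 := by rw [div_le_iff₀ (by linarith)]; linarith
          linarith) (by norm_num) (by norm_num)
    simpa using h1
  refine inHalfPlane_of_step (p := fun n => ((n : ℝ) + 1) / 2) ?_ ?_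
  -- Index 0 enters with p = 1: the value 1/2 of the general formula would only give p' ≤ 0.
  · exact hstep 0 1 _ one_pos (by norm_num) h0
  · intro n hn h
    have hn' : (1 : ℝ) ≤ n := by exact_mod_cast hn
    refine hstep n _ _ (by positivity) ?_ h
    rw [show 2 * (2 * (((n : ℝ) + 1) / 2)) = 2 * (n + 1) by ring]
    have : ((n : ℝ) + 4) / (2 * (n + 1)) ≤ 5 / 4 := by
      rw [div_le_iff₀ (by positivity)]; linarith
    push_cast
    linarith

/-- The third exceptional family: `l = 2`, `m = d`, with `D = d - 2`. -/
lemma IsHeunSeq.inHalfPlane_of_l_two_of_m_max {D : ℝ} {z : ℂ} {a : ℕ → ℂ} (hD : 2 ≤ D)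
    (hz : 0 ≤ z.re)
    (ha : IsHeunSeq D (D / 2 + 4) ((2 * z + 1 - D) / 2) 0 (D * z ^ 2 + 7 * D * z + 8 * D - 8)
      ((z + 3) * (z + 4)) a) :
    ∀ n : ℕ, n ≥ 0 → InHalfPlane a (D / 2 + 4) (z + 3) ((n : ℝ) / 2 + 1) n := by
  have hDc : (D : ℂ) ≠ 0 := by exact_mod_cast (by linarith : D ≠ 0)
  have hC : ∀ n : ℕ, 6 + 2 * n + 4 * ((n : ℝ) + 2) * (n + 3) / D
      ≤ 6 + 2 * n + 2 * ((n : ℝ) + 2) * (n + 3) := by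
    intro n
    have : 4 * ((n : ℝ) + 2) * (n + 3) / D ≤ 2 * ((n : ℝ) + 2) * (n + 3) := by
      rw [div_le_iff₀ (by linarith)]
      nlinarith [show (0 : ℝ) ≤ (n + 2) * (n + 3) by positivity]
    linarith
  have hqv : ∀ n : ℕ, (2 * n + 5 : ℝ) ≤ (2 * n + 2 + (z + 3) : ℂ).re := by
    intro n; simp; linarith
  have hv0 : ∀ n : ℕ, (2 * n + 2 + (z + 3) : ℂ) ≠ 0 := by
    intro n h0
    have := hqv n
    rw [h0, Complex.zero_re] at this
    have : (0 : ℝ) ≤ n := Nat.cast_nonneg n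
    linarith
  refine inHalfPlane_of_step (p := fun n => (n : ℝ) / 2 + 1) ?_ ?_
  · have h00 : a 0 ≠ 0 := by rw [ha.zero]; exact one_ne_zero
    refine ⟨h00, ?_⟩
    have h1 := half_plane_start (a1 := a 0) (a2 := a 1) (α' := 4 * (D / 2 + 4)) (D := D)
      (N := D * z ^ 2 + 7 * D * z + 8 * D - 8) (v := z + 3) (p' := 1) (q := 3) (e := 1)
      (c := 4 + 8 / D) (C := 8) (by linarith) three_pos (by simp; linarith) h00
      (by rw [← ha.one]; push_cast; ring) (by push_cast; field_simp; ring)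
      (by have : 8 / D ≤ 4 := by rw [div_le_iff₀ (by linarith)]; linarith
          linarith) (by norm_num) (by norm_num)
    simpa using h1
  · intro n _ h
    have hn : (0 : ℝ) ≤ n := Nat.cast_nonneg n
    refine ha.inHalfPlane_succ (β := 1 - ((1 : ℝ) : ℂ) / (2 * n + 2 + (z + 3))) (q := 2 * n + 5)
      (e := 1) (c := 6 + 2 * n + 4 * ((n : ℝ) + 2) * (n + 3) / D) (by linarith) (by linarith)
      (by positivity) (by positivity) (hqv n) ?_ ?_
      (norm_sub_re_one_sub_div_le (q := 2 * n + 5) zero_le_one (by positivity)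
        (by linarith) (hqv n))
      (hC n) (by positivity) ?_ h
    · push_cast; field_simp; ring
    · rw [one_sub_div_mul_mul _ _ (hv0 n)]
      push_cast
      ring
    · have h1 : 4 * ((n : ℝ) + 1) * (n + (D / 2 + 4)) / D ≤ 2 * (n + 1) * (n + 5) := by
        rw [div_le_iff₀ (by linarith)]
        nlinarith [mul_nonneg (show (0 : ℝ) ≤ (n + 1) * (n + 4) by positivity) (sub_nonneg.2 hD)]
      have h2 : 4 * ((n : ℝ) + 1) * (n + (D / 2 + 4)) / D * (1 / (2 * (2 * n + 5))
          / (2 * (n / 2 + 1))) ≤ 2 * (n + 1) * (n + 5) * (1 / (2 * (2 * n + 5))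
          / (2 * (n / 2 + 1))) := by gcongr
      have h3 : 2 * ((n : ℝ) + 1) * (n + 5) * (1 / (2 * (2 * n + 5)) / (2 * (n / 2 + 1)))
          ≤ 3 / 5 := by
        rw [show 2 * ((n : ℝ) / 2 + 1) = n + 2 by ring,
          show 2 * ((n : ℝ) + 1) * (n + 5) * (1 / (2 * (2 * n + 5)) / (n + 2))
            = (n + 1) * (n + 5) / ((2 * n + 5) * (n + 2)) by field_simp,
          div_le_iff₀ (by positivity)]
        nlinarith [sq_nonneg ((n : ℝ) - 3 / 2)]
      have h4 : (6 + 2 * n + 2 * ((n : ℝ) + 2) * (n + 3)) / (2 * n + 5) ≤ n + 18 / 5 := by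
        rw [div_le_iff₀ (by positivity)]; nlinarith
      push_cast
      linarith

/-- The invariant of the generic family is propagated from the index `1`, with `D = d - 2`. -/
lemma IsHeunSeq.inHalfPlane_of_generic {D l m : ℝ} {z : ℂ} {a : ℕ → ℂ} (hD : 2 ≤ D) (hl : 1 ≤ l)
    (hm : m ≤ l + D) (hz : 0 ≤ z.re)
    (ha : IsHeunSeq D (D / 2 + 1 + l) ((2 * z + 1 - D) / 2) (-2)
      (D * l ^ 2 + (D + 4) * l + D * z * (2 * l + z + 1) - 2 * D - 4 * m)
      ((z + l - 1) * (z + l - 2)) a)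
    (h1 : InHalfPlane a (D / 2 + 1 + l) (z + l - 2) (3 / 2) 1) :
    ∀ n : ℕ, n ≥ 1 → InHalfPlane a (D / 2 + 1 + l) (z + l - 2) ((n : ℝ) / 2 + 1) n := by
  have hDc : (D : ℂ) ≠ 0 := by exact_mod_cast (by linarith : D ≠ 0)
  have hqv : ∀ n : ℕ, (2 * n + l : ℝ) ≤ (2 * n + 2 + (z + l - 2) : ℂ).re := by
    intro n; simp; linarith
  refine inHalfPlane_of_step (p := fun n => (n : ℝ) / 2 + 1) ?_ ?_
  · convert h1 using 1; norm_num
  · intro n hn h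
    have hn : (1 : ℝ) ≤ n := by exact_mod_cast hn
    have hv0 : (2 * n + 2 + (z + l - 2) : ℂ) ≠ 0 := by
      intro h0
      have := hqv n
      rw [h0, Complex.zero_re] at this
      linarith
    have hC : 2 * n - 2 + (4 * (n : ℝ) ^ 2 + 4 * n * l - 4 + 4 * m) / D
        ≤ 2 * ((n : ℝ) + l) * (n + 1) := by
      have e1 : (4 * (n : ℝ) ^ 2 + 4 * n * l - 4 + 4 * m) / D
          ≤ (4 * (n : ℝ) ^ 2 + 4 * n * l - 4 + 4 * l + 4 * D) / D := by
        gcongr ?_ / D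
        linarith
      have e2 : (4 * (n : ℝ) ^ 2 + 4 * n * l - 4 + 4 * l + 4 * D) / D
          ≤ 2 * (n : ℝ) ^ 2 + 2 * n * l - 2 + 2 * l + 4 := by
        rw [div_le_iff₀ (by linarith)]
        have : 0 ≤ 2 * (n : ℝ) ^ 2 + 2 * n * l - 2 + 2 * l := by nlinarith
        nlinarith
      nlinarith
    refine ha.inHalfPlane_succ (β := 1 - ((1 : ℝ) : ℂ) / (2 * n + 2 + (z + l - 2)))
      (q := 2 * n + l) (e := 5) (c := 2 * n - 2 + (4 * (n : ℝ) ^ 2 + 4 * n * l - 4 + 4 * m) / D)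
      (by linarith) (by linarith)
      (by positivity) (by positivity) (hqv n) ?_ ?_
      (norm_sub_re_one_sub_div_le (q := 2 * n + l) zero_le_one (by positivity)
        (by linarith) (hqv n))
      hC (by positivity) ?_ h
    · push_cast; field_simp; ring
    · rw [one_sub_div_mul_mul _ _ hv0]
      push_cast
      ring
    · have h1 : 4 * ((n : ℝ) + 1) * (n + (D / 2 + 1 + l)) / D ≤ 2 * (n + 1) * (n + l + 2) := by
        rw [div_le_iff₀ (by linarith)]
        nlinarith [mul_nonneg (show (0 : ℝ) ≤ (n + 1) * (n + l + 1) by positivity)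
          (sub_nonneg.2 hD)]
      have h2 : 4 * ((n : ℝ) + 1) * (n + (D / 2 + 1 + l)) / D * (1 / (2 * (2 * n + l))
          / (2 * (n / 2 + 1))) ≤ 2 * (n + 1) * (n + l + 2) * (1 / (2 * (2 * n + l))
          / (2 * (n / 2 + 1))) := by gcongr
      have h3 : 2 * ((n : ℝ) + 1) * (n + l + 2) * (1 / (2 * (2 * n + l)) / (2 * (n / 2 + 1)))
          ≤ 4 / 3 := by
        have : 2 * (n : ℝ) + l ≠ 0 := by positivity
        rw [show 2 * ((n : ℝ) / 2 + 1) = n + 2 by ring,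
          show 2 * ((n : ℝ) + 1) * (n + l + 2) * (1 / (2 * (2 * n + l)) / (n + 2))
            = (n + 1) * (n + l + 2) / ((2 * n + l) * (n + 2)) by field_simp,
          div_le_iff₀ (by positivity)]
        nlinarith
      have h4 : (2 * ((n : ℝ) + l) * (n + 1)) / (2 * n + l) ≤ n + l / 2 + 2 := by
        rw [div_le_iff₀ (by positivity)]; nlinarith
      push_cast
      linarith

/-- The generic family at the index `1` for `2 ≤ l`. -/
lemma IsHeunSeq.inHalfPlane_one_of_two_le {D l m : ℝ} {z : ℂ} {a : ℕ → ℂ} (hD : 2 ≤ D)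
    (hl : 2 ≤ l) (hm : m ≤ l ∨ 3 ≤ l ∧ m ≤ l + D) (hz : 0 ≤ z.re)
    (ha : IsHeunSeq D (D / 2 + 1 + l) ((2 * z + 1 - D) / 2) (-2)
      (D * l ^ 2 + (D + 4) * l + D * z * (2 * l + z + 1) - 2 * D - 4 * m)
      ((z + l - 1) * (z + l - 2)) a) :
    InHalfPlane a (D / 2 + 1 + l) (z + l - 2) (3 / 2) 1 := by
  have hDc : (D : ℂ) ≠ 0 := by exact_mod_cast (by linarith : D ≠ 0)
  have hm' : m ≤ l + D := by rcases hm with h | h <;> linarith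
  have h00 : a 0 ≠ 0 := by rw [ha.zero]; exact one_ne_zero
  -- At index 0 the usual denominator z+l-2 can vanish when l = 2. It is replaced by z+l-1, at the
  -- price of β = 1 - 2/(z+l) in the next step.
  have hs : 1 ≤ (((4 * (D / 2 + 1 + l) : ℝ) : ℂ) * (a 1 / a 0) / (z + l - 1)).re := by
    have hone : (((4 * (D / 2 + 1 + l) : ℝ) : ℂ)) * D * a 1
        = (D * l ^ 2 + (D + 4) * l + D * z * (2 * l + z + 1) - 2 * D - 4 * m) * a 0 := by
      rw [← ha.one]; push_cast; ring
    have hN : (D * l ^ 2 + (D + 4) * l + D * z * (2 * l + z + 1) - 2 * D - 4 * m : ℂ)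
        = D * ((z + l - 1) * (z + l - 1 + (3 : ℝ)) - (4 * (m - l) / D : ℝ)) := by
      push_cast; field_simp; ring
    -- For m ≤ l the correction c is nonpositive. For m up to l+D it is at most 4, and l = 2 would
    -- leave the lower bound 1 + 3 - 4 = 0; this is why l = 2, m = d is exceptional.
    rcases hm with h | h
    · refine half_plane_start (q := l - 1) (C := 0) (by linarith) (by linarith) ?_ h00 hone hN
        ?_ le_rfl ?_
      · simp; linarith
      · exact div_nonpos_of_nonpos_of_nonneg (by linarith) (by linarith)
      · rw [zero_div]; linarith
    · refine half_plane_start (q := l - 1) (C := 4) (by linarith) (by linarith) ?_ h00 hone hN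
        ?_ (by norm_num) ?_
      · simp; linarith
      · rw [div_le_iff₀ (by linarith)]; linarith
      · have : 4 / (l - 1) ≤ 2 := by rw [div_le_iff₀ (by linarith)]; linarith
        linarith
  have hstep := ha.step 0
  have hqv : l ≤ (z + (l : ℂ)).re := by simp [hz]
  have hv0 : z + (l : ℂ) ≠ 0 := by
    intro h0
    rw [h0, Complex.zero_re] at hqv
    linarith
  have := half_plane_step (a := a 0) (w := z + l - 1) (v := z + l) (p' := 3 / 2)
    (α := 4 * (D / 2 + 1 + l)) (q := l)
    (β := 1 - ((2 : ℝ) : ℂ) / (z + l)) (e := 5) (c := -2 + (-4 + 4 * m) / D) (C := 2 * l)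
    (by linarith : 0 < D) (by linarith) one_pos (by linarith) hqv hstep
    (by push_cast; field_simp; ring)
    (by rw [one_sub_div_mul_mul _ _ hv0]; push_cast; ring)
    (norm_sub_re_one_sub_div_le two_pos.le (by linarith) hl hqv) ?_ (by linarith) hs ?_
  · refine ⟨this.1, this.2.trans_eq ?_⟩
    push_cast
    ring_nf
  · have : (-4 + 4 * m) / D ≤ 2 * l + 2 := by
      rw [div_le_iff₀ (by linarith)]; nlinarith
    linarith
  · have h1 : 4 * (D / 2 + 1 + l) / D ≤ 2 * (l + 2) := by
      rw [div_le_iff₀ (by linarith)]; nlinarith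
    have h2 : 4 * (D / 2 + 1 + l) / D * (2 / (2 * l) / (2 * 1))
        ≤ 2 * (l + 2) * (2 / (2 * l) / (2 * 1)) := by gcongr
    have h3 : 2 * (l + 2) * (2 / (2 * l) / (2 * 1)) ≤ 2 := by
      rw [show 2 * (l + 2) * (2 / (2 * l) / (2 * 1)) = (l + 2) / l by field_simp,
        div_le_iff₀ (by linarith)]
      linarith
    have h4 : 2 * l / l = 2 := by field_simp
    linarith

/-- The generic family at the index `1` for `l = 1`, `m = -1`. -/
lemma IsHeunSeq.inHalfPlane_one_of_l_one {D : ℝ} {z : ℂ} {a : ℕ → ℂ} (hD : 2 ≤ D)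
    (hz : 0 ≤ z.re)
    (ha : IsHeunSeq D (D / 2 + 1 + 1) ((2 * z + 1 - D) / 2) (-2)
      (D * z ^ 2 + 3 * D * z + 8) (z * (z - 1)) a) :
    InHalfPlane a (D / 2 + 1 + 1) (z - 1) (3 / 2) 1 := by
  have hDc : (D : ℂ) ≠ 0 := by exact_mod_cast (by linarith : D ≠ 0)
  have hD0 : 0 < D := by linarith
  set E : ℂ := z ^ 2 + 3 * z + ((8 / D : ℝ) : ℂ) with hE
  have hone : ((4 * (D / 2 + 1 + 1) : ℝ) : ℂ) * a 1 = E := by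
    have := ha.one
    rw [ha.zero] at this
    have h2 : (D : ℂ) * (((4 * (D / 2 + 1 + 1) : ℝ) : ℂ) * a 1) = D * E := by
      rw [hE]
      have h4 : (D : ℂ) * (8 / D) = 8 := by field_simp
      push_cast at this ⊢
      linear_combination this - h4
    exact mul_left_cancel₀ hDc h2
  -- For l = 1 both z-1 and z are unusable as denominators at index 0, so the term is estimated
  -- directly. The bound follows from Re(E z̄) = |z|² Re z + 3|z|² + (8/D) Re z.
  have hEn : 3 * ‖z‖ ≤ ‖E‖ := by
    have haux : ∀ t : ℝ, 0 ≤ t → 3 * Complex.normSq z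
        ≤ ((z ^ 2 + 3 * z + (t : ℂ)) * (starRingEnd ℂ) z).re := by
      intro t ht
      obtain ⟨x, y⟩ := z
      simp only at hz
      simp [Complex.normSq_apply, pow_two]
      have := mul_nonneg ht hz
      have := mul_nonneg hz (add_nonneg (mul_self_nonneg x) (mul_self_nonneg y))
      linarith
    have h1 : 3 * ‖z‖ ^ 2 ≤ (E * (starRingEnd ℂ) z).re := by
      rw [← Complex.normSq_eq_norm_sq]
      exact haux _ (by positivity)
    have h2 := h1.trans (Complex.re_le_norm _)
    rw [norm_mul, Complex.norm_conj] at h2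
    rcases (norm_nonneg z).eq_or_lt with h | h
    · rw [← h]; simp
    · nlinarith
  have hE0 : E ≠ 0 := by
    intro h0
    rw [h0, norm_zero] at hEn
    have : z = 0 := norm_le_zero_iff.1 (by linarith)
    rw [hE, this] at h0
    have h0 := congrArg Complex.re h0
    simp at h0
    linarith
  have hγ0 : ((4 * (D / 2 + 1 + 1) : ℝ) : ℂ) ≠ 0 := by
    rw [Complex.ofReal_ne_zero]; positivity
  have ha1' : a 1 = E / ((4 * (D / 2 + 1 + 1) : ℝ) : ℂ) := by
    rw [← hone, mul_div_cancel_left₀ _ hγ0]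
  have ha1 : a 1 ≠ 0 := by rw [ha1']; exact div_ne_zero hE0 hγ0
  refine ⟨ha1, ?_⟩
  have h0 := ha.step 0
  rw [ha.zero, zero_add] at h0
  have hqv : 1 ≤ (z + 1).re := by simp [hz]
  have hv0 : z + 1 ≠ 0 := by
    intro h0
    rw [h0, Complex.zero_re] at hqv
    linarith
  have key : ((4 * ((1 : ℕ) + 1) * ((1 : ℕ) + (D / 2 + 1 + 1)) : ℝ) : ℂ) * (a (1 + 1) / a 1)
        / (2 * (1 : ℕ) + (z - 1))
      = ((z + 1) + (5 : ℝ) - ((-2 - 8 / D : ℝ) : ℂ) / (z + 1))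
        + ((4 * (D / 2 + 1 + 1) / D : ℝ) : ℂ) * (z * (z - 1) / (E * (z + 1))) := by
    have e1 : ((4 * ((1 : ℕ) + 1) * ((1 : ℕ) + (D / 2 + 1 + 1)) : ℝ) : ℂ) * a (1 + 1)
        = ((z + 1) * ((z + 1) + (5 : ℝ)) - ((-2 - 8 / D : ℝ) : ℂ)) * a 1 + z * (z - 1) / D := by
      field_simp
      push_cast at h0 ⊢
      field_simp at h0 ⊢
      linear_combination h0
    have e2 : (2 * (1 : ℕ) + (z - 1) : ℂ) = z + 1 := by push_cast; ring
    rw [e2, mul_div_assoc', e1]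
    generalize ((-2 - 8 / D : ℝ) : ℂ) = c
    rw [add_div, mul_div_cancel_right₀ _ ha1, ha1', Complex.ofReal_div]
    field_simp
  rw [key, Complex.add_re]
  have t1 := re_add_sub_div_ge (e := 5) (c := -2 - 8 / D) (C := 0) one_pos hqv
    (by have : 0 ≤ 8 / D := by positivity
        linarith) le_rfl
  have t2 : ‖((4 * (D / 2 + 1 + 1) / D : ℝ) : ℂ) * (z * (z - 1) / (E * (z + 1)))‖ ≤ 2 := by
    have s1 : 4 * (D / 2 + 1 + 1) / D ≤ 6 := by rw [div_le_iff₀ hD0]; linarith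
    have s2 : ‖z - 1‖ ≤ ‖z + 1‖ := by
      rw [Complex.norm_def, Complex.norm_def]
      apply Real.sqrt_le_sqrt
      simp [Complex.normSq_apply]
      nlinarith
    have s3 : ‖z * (z - 1) / (E * (z + 1))‖ ≤ 1 / 3 := by
      rw [norm_div, norm_mul, norm_mul, div_le_div_iff₀
        (mul_pos (norm_pos_iff.2 hE0) (norm_pos_iff.2 hv0)) (by norm_num)]
      nlinarith [mul_le_mul hEn s2 (norm_nonneg _) (norm_nonneg _)]
    rw [norm_mul, Complex.norm_real, Real.norm_of_nonneg (by positivity)]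
    calc _ ≤ 6 * (1 / 3 : ℝ) := by gcongr
      _ = 2 := by norm_num
  have t3 := (abs_le.1 ((Complex.abs_re_le_norm _).trans t2)).1
  linarith

/-! ### Comparison with the binomial series of (1-x)^(-β). -/

/-- The ratio `a (n + 1) / a n` is `1 + ρ / n + O(1 / n²)`. -/
def HasRatioExpansion (a : ℕ → ℂ) (ρ : ℂ) : Prop :=
  (∀ᶠ n in atTop, a n ≠ 0) ∧
    (fun n : ℕ => a (n + 1) / a n - 1 - ρ * (((n : ℝ) + 1)⁻¹ : ℝ))
      =O[atTop] fun n : ℕ => (((n : ℝ) + 1)⁻¹) ^ 2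

lemma HasRatioExpansion.tendsto {a : ℕ → ℂ} {ρ : ℂ} (h : HasRatioExpansion a ρ) :
    Tendsto (fun n => a (n + 1) / a n) atTop (𝓝 1) := by
  have ht := tendsto_inv_natCast_add_one
  have h1 := h.2.trans_tendsto (by simpa using ht.pow 2)
  have h2 : Tendsto (fun n : ℕ => ρ * (((n : ℝ) + 1)⁻¹ : ℝ)) atTop (𝓝 0) := by
    have := ((Complex.continuous_ofReal.tendsto 0).comp ht).const_mul ρ
    simpa using this
  have := (h1.add h2).add_const 1
  simpa using this

lemma multichoose_succ_mul (β : ℂ) (n : ℕ) :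
    ((n : ℂ) + 1) * Ring.multichoose β (n + 1) = (β + n) * Ring.multichoose β n := by
  have h1 := Ring.factorial_nsmul_multichoose_eq_ascPochhammer β n
  have h2 := Ring.factorial_nsmul_multichoose_eq_ascPochhammer β (n + 1)
  rw [Polynomial.ascPochhammer_smeval_eq_eval] at h1 h2
  rw [ascPochhammer_succ_eval, ← h1, Nat.factorial_succ] at h2
  have h3 : (n.factorial : ℂ) ≠ 0 := by exact_mod_cast n.factorial_ne_zero
  simp only [nsmul_eq_mul] at h2
  push_cast at h2
  apply mul_left_cancel₀ h3
  linear_combination h2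

lemma multichoose_ne_zero {β : ℂ} (hβ : 0 < β.re) (n : ℕ) : Ring.multichoose β n ≠ 0 := by
  induction n with
  | zero => simp
  | succ n ih =>
    intro h
    have := multichoose_succ_mul β n
    rw [h, mul_zero, eq_comm, mul_eq_zero] at this
    rcases this with h1 | h1
    · have := congrArg Complex.re h1
      simp at this
      have : (0 : ℝ) ≤ n := Nat.cast_nonneg n
      linarith
    · exact ih h1

lemma hasSum_multichoose (β : ℂ) {x : ℝ} (hx0 : 0 ≤ x) (hx1 : x < 1) :
    HasSum (fun n => Ring.multichoose β n * (x : ℂ) ^ n) (1 / (1 - (x : ℂ)) ^ β) := by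
  have h := (Complex.one_div_one_sub_cpow_hasFPowerSeriesOnBall_zero β).hasSum (y := (x : ℂ))
    (by simpa [enorm_eq_nnnorm, ← NNReal.coe_lt_coe, abs_of_nonneg hx0] using hx1)
  simpa [FormalMultilinearSeries.ofScalars, Ring.multichoose_eq, mul_comm] using h

/-- A sequence with ratios `1 + O(1 / n²)` converges to a nonzero limit. -/
lemma exists_tendsto_of_ratio {x : ℕ → ℂ} (hx : ∀ᶠ n in atTop, x n ≠ 0)
    (h : (fun n => x (n + 1) / x n - 1) =O[atTop] fun n : ℕ => (((n : ℝ) + 1)⁻¹) ^ 2) :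
    ∃ c : ℂ, c ≠ 0 ∧ Tendsto x atTop (𝓝 c) := by
  obtain ⟨N, hN⟩ := eventually_atTop.1 hx
  set f : ℕ → ℂ := fun n => x (n + N + 1) / x (n + N) - 1 with hf
  have hsum0 : Summable fun n => x (n + 1) / x n - 1 := by
    refine summable_of_isBigO_nat ?_ h
    have := (summable_nat_add_iff 1).2 (Real.summable_nat_pow_inv.2 (one_lt_two))
    simpa using this
  have hsum : Summable f := by
    have := (summable_nat_add_iff N).2 hsum0
    exact this
  have hne : ∀ n, 1 + f n ≠ 0 := by
    intro n
    simp only [hf, add_sub_cancel]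
    exact div_ne_zero (hN _ (by omega)) (hN _ (by omega))
  have hprod := (multipliable_one_add_of_summable hsum.norm).hasProd.tendsto_prod_nat
  -- The product of the ratios telescopes, so the limit is an absolutely convergent infinite product
  -- with nonzero factors.
  have heq : ∀ n, ∏ i ∈ Finset.range n, (1 + f i) = x (n + N) / x N := by
    intro n
    induction n with
    | zero => simp [hN N le_rfl]
    | succ n ih =>
      rw [Finset.prod_range_succ, ih]
      simp only [hf, add_sub_cancel]
      have := hN (n + N) (by omega)
      rw [show n + 1 + N = n + N + 1 by ring]
      field_simp
  refine ⟨(∏' i, (1 + f i)) * x N, mul_ne_zero (tprod_one_add_ne_zero_of_summable hne hsum.norm)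
    (hN N le_rfl), ?_⟩
  rw [← tendsto_add_atTop_iff_nat N]
  refine (hprod.mul_const (x N)).congr fun n => ?_
  rw [heq, div_mul_cancel₀ _ (hN N le_rfl)]

open Asymptotics in
/-- Quotients of sequences with the same first order ratio expansion converge. -/
lemma HasRatioExpansion.exists_tendsto_div {a b : ℕ → ℂ} {ρ : ℂ} (ha : HasRatioExpansion a ρ)
    (hb : HasRatioExpansion b ρ) :
    ∃ c : ℂ, c ≠ 0 ∧ Tendsto (fun n => a n / b n) atTop (𝓝 c) := by
  have hbt := hb.tendsto
  refine exists_tendsto_of_ratio ?_ ?_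
  · filter_upwards [ha.1, hb.1] with n h1 h2 using div_ne_zero h1 h2
  · have h1 : (fun n => a (n + 1) / a n - b (n + 1) / b n) =O[atTop]
        fun n : ℕ => (((n : ℝ) + 1)⁻¹) ^ 2 :=
      (ha.2.sub hb.2).congr_left fun n => by ring
    have h2 : (fun n => (b (n + 1) / b n)⁻¹) =O[atTop] fun _ => (1 : ℝ) :=
      (hbt.inv₀ one_ne_zero).isBigO_one ℝ
    have h3 := (h1.mul h2).congr_right fun n => mul_one _
    refine h3.congr' ?_ EventuallyEq.rfl
    filter_upwards [ha.1, hb.1, (tendsto_add_atTop_nat 1).eventually hb.1] with n h1 h2 h3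
    field_simp

/-- The ratio is (β+n)/(n+1) = 1 + (β-1)/(n+1), with no error term. -/
lemma hasRatioExpansion_multichoose {β : ℂ} (hβ : 0 < β.re) :
    HasRatioExpansion (Ring.multichoose β) (β - 1) := by
  refine ⟨Eventually.of_forall fun n => multichoose_ne_zero hβ n, ?_⟩
  refine (Asymptotics.isBigO_zero _ _).congr_left fun n => ?_
  have h1 := multichoose_succ_mul β n
  have h2 := multichoose_ne_zero hβ n
  have h3 : (n : ℂ) + 1 ≠ 0 := by exact_mod_cast n.succ_ne_zero
  rw [eq_comm, sub_sub, sub_eq_zero]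
  push_cast
  rw [div_eq_iff h2]
  apply mul_left_cancel₀ h3
  rw [h1]
  field_simp
  ring

/-- The imaginary part of β enters |β+n|/(Re β+n) only quadratically, so the quotient of the moduli
has ratios 1 + O(1/n²) and converges. This allows comparison with a series of nonnegative terms. -/
lemma norm_multichoose_isBigO {β : ℂ} (hβ : 0 < β.re) :
    Ring.multichoose β =O[atTop] Ring.multichoose (β.re : ℂ) := by
  have hβ' : 0 < ((β.re : ℂ)).re := by simpa using hβ
  set x : ℕ → ℂ := fun n =>
    ((‖Ring.multichoose β n‖ / ‖Ring.multichoose (β.re : ℂ) n‖ : ℝ) : ℂ) with hx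
  have hx0 : ∀ n, x n ≠ 0 := fun n => by
    simp only [hx, Complex.ofReal_ne_zero]
    exact div_ne_zero (norm_ne_zero_iff.2 (multichoose_ne_zero hβ n))
      (norm_ne_zero_iff.2 (multichoose_ne_zero hβ' n))
  have hratio : ∀ n : ℕ, x (n + 1) / x n = ((‖β + n‖ / (β.re + n) : ℝ) : ℂ) := by
    intro n
    have h1 := congrArg norm (multichoose_succ_mul β n)
    have h2 := congrArg norm (multichoose_succ_mul (β.re : ℂ) n)
    rw [norm_mul, norm_mul] at h1 h2
    have h3 : ‖(β.re : ℂ) + n‖ = β.re + n := by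
      rw [← Complex.ofReal_natCast, ← Complex.ofReal_add, Complex.norm_real,
        Real.norm_of_nonneg (by positivity)]
    have h4 : ‖(n : ℂ) + 1‖ ≠ 0 := norm_ne_zero_iff.2 (by exact_mod_cast n.succ_ne_zero)
    rw [h3] at h2
    simp only [hx]
    rw [← Complex.ofReal_div]
    congr 1
    have h5 := norm_ne_zero_iff.2 (multichoose_ne_zero hβ n)
    have h6 := norm_ne_zero_iff.2 (multichoose_ne_zero hβ' n)
    have h7 := norm_ne_zero_iff.2 (multichoose_ne_zero hβ' (n + 1))
    have h8 : β.re + n ≠ 0 := by positivity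
    rw [div_div_div_eq, div_eq_div_iff (mul_ne_zero h7 h5) h8]
    apply mul_left_cancel₀ h4
    linear_combination (‖Ring.multichoose (β.re : ℂ) n‖ * (β.re + n)) * h1
      - ‖β + n‖ * ‖Ring.multichoose β n‖ * h2
  obtain ⟨c, -, hc⟩ := exists_tendsto_of_ratio (Eventually.of_forall hx0) (x := x) (by
    refine Asymptotics.IsBigO.of_bound (β.im ^ 2 * (1 + 1 / β.re) ^ 2)
      (Eventually.of_forall fun n => ?_)
    have hp : 0 < β.re + n := by positivity
    have h1 : β.re + n ≤ ‖β + n‖ := by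
      refine le_trans ?_ (Complex.re_le_norm _)
      simp
    have h2 : ‖β + n‖ ^ 2 = (β.re + n) ^ 2 + β.im ^ 2 := by
      rw [← Complex.normSq_eq_norm_sq, Complex.normSq_apply]
      simp
      ring
    rw [hratio, ← Complex.ofReal_one, ← Complex.ofReal_sub, Complex.norm_real,
      Real.norm_of_nonneg (by rw [sub_nonneg, one_le_div hp]; exact h1),
      Real.norm_of_nonneg (by positivity)]
    have h3 : ‖β + n‖ / (β.re + n) - 1 ≤ β.im ^ 2 * ((β.re + n)⁻¹) ^ 2 := by
      rw [div_sub_one hp.ne', inv_pow, ← div_eq_mul_inv, div_le_div_iff₀ hp (by positivity)]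
      nlinarith [mul_le_mul_of_nonneg_right h1 hp.le, mul_nonneg (sub_nonneg.2 h1) hp.le]
    have h4 : (β.re + n)⁻¹ ≤ (1 + 1 / β.re) * ((n : ℝ) + 1)⁻¹ := by
      rw [inv_eq_one_div, ← div_eq_mul_inv, div_le_div_iff₀ hp (by positivity)]
      have : 1 / β.re * β.re = 1 := by field_simp
      have : 0 ≤ 1 / β.re * n := by positivity
      nlinarith
    calc _ ≤ β.im ^ 2 * ((β.re + n)⁻¹) ^ 2 := h3
      _ ≤ β.im ^ 2 * ((1 + 1 / β.re) * ((n : ℝ) + 1)⁻¹) ^ 2 := by gcongr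
      _ = _ := by ring)
  have hb := hc.isBigO_one ℝ
  obtain ⟨C, hC⟩ := hb.bound
  refine Asymptotics.IsBigO.of_bound C ?_
  filter_upwards [hC] with n hn
  have h6 := norm_pos_iff.2 (multichoose_ne_zero hβ' n)
  rw [Complex.norm_real, Real.norm_of_nonneg (by positivity), norm_one, mul_one,
    div_le_iff₀ h6] at hn
  exact hn

lemma summable_of_tendsto_ratio {a : ℕ → ℂ} (ha : ∀ᶠ n in atTop, a n ≠ 0)
    (hr : Tendsto (fun n => a (n + 1) / a n) atTop (𝓝 1)) {x : ℝ} (hx : |x| < 1) :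
    Summable fun n => ‖a n‖ * |x| ^ n := by
  rcases eq_or_ne x 0 with rfl | h0
  · refine summable_of_ne_finset_zero (s := {0}) fun n hn => ?_
    simp at hn
    simp [hn]
  have hx0 : 0 < |x| := abs_pos.2 h0
  refine summable_of_ratio_test_tendsto_lt_one hx ?_ ?_
  · filter_upwards [ha] with n hn
    have := norm_pos_iff.2 hn
    positivity
  · have := hr.norm.mul_const |x|
    rw [norm_one, one_mul] at this
    refine this.congr' ?_
    filter_upwards [ha] with n hn
    have h1 := norm_pos_iff.2 hn
    rw [norm_div, Real.norm_of_nonneg (by positivity), Real.norm_of_nonneg (by positivity)]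
    field_simp
    ring

lemma hasSum_powerSeries {a : ℕ → ℂ} (ha : ∀ᶠ n in atTop, a n ≠ 0)
    (hr : Tendsto (fun n => a (n + 1) / a n) atTop (𝓝 1)) {x : ℝ} (hx : |x| < 1) :
    HasSum (fun n => a n * (x : ℂ) ^ n) (∑' n, a n * (x : ℂ) ^ n) := by
  apply Summable.hasSum
  apply Summable.of_norm
  simpa using summable_of_tendsto_ratio ha hr hx

/-- If the ratios of the coefficients are `1 + ρ / n + O(1 / n²)` with `-1 < re ρ`, then the power
series is unbounded near `1`. -/
lemma HasRatioExpansion.not_bounded {a : ℕ → ℂ} {ρ : ℂ} (ha : HasRatioExpansion a ρ)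
    (hρ : -1 < ρ.re) (M : ℝ) :
    ¬ ∀ x ∈ Ioo (0 : ℝ) 1, ‖∑' n, a n * (x : ℂ) ^ n‖ ≤ M := by
  intro hM
  set β : ℂ := ρ + 1 with hβdef
  have hβ : 0 < β.re := by simp [hβdef]; linarith
  have hc := hasRatioExpansion_multichoose hβ
  rw [show β - 1 = ρ by rw [hβdef]; ring] at hc
  obtain ⟨C, hC0, hC⟩ := ha.exists_tendsto_div hc
  set c : ℕ → ℂ := Ring.multichoose β with hcdef
  set k : ℕ → ℝ := fun n => Ring.choose (β.re + n - 1) n with hk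
  have hkc : ∀ n, Ring.multichoose (β.re : ℂ) n = (k n : ℂ) := by
    intro n
    simp only [hk]
    rw [Ring.multichoose_eq, Complex.ofReal_choose]
    push_cast
    rfl
  have hkpos : ∀ n, 0 ≤ k n := by
    intro n
    have hβ' : 0 < ((β.re : ℂ)).re := by simpa using hβ
    induction n with
    | zero => simp [hk]
    | succ n ih =>
      have := multichoose_succ_mul (β.re : ℂ) n
      rw [hkc, hkc] at this
      have h2 : ((n : ℝ) + 1) * k (n + 1) = (β.re + n) * k n := by exact_mod_cast this
      have h3 : 0 ≤ (β.re + n) * k n := by positivity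
      rw [← h2] at h3
      exact nonneg_of_mul_nonneg_right h3 (by positivity)
  have hO := norm_multichoose_isBigO hβ
  have ho : (fun n => a n - C * c n) =o[atTop] k := by
    have h1 : (fun n => a n / c n - C) =o[atTop] fun _ => (1 : ℝ) := by
      rw [Asymptotics.isLittleO_one_iff]
      simpa using hC.sub_const C
    have h2 : c =O[atTop] k := by
      refine hO.trans (Asymptotics.IsBigO.of_bound 1 (Eventually.of_forall fun n => ?_))
      rw [hkc]; simp
    have := h1.mul_isBigO h2
    refine (this.congr_left fun n => ?_).congr_right fun n => one_mul _
    have := multichoose_ne_zero hβ n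
    rw [← hcdef] at this
    field_simp
  have hCn : 0 < ‖C‖ := norm_pos_iff.2 hC0
  obtain ⟨N, hN⟩ := eventually_atTop.1 (ho.def (half_pos hCn))
  -- The finitely many terms before the asymptotic estimate applies; they contribute at most the
  -- constant K.
  set f : ℕ → ℝ := fun n => if n < N then ‖a n - C * c n‖ else 0 with hf
  have hfs : HasSum f (∑ n ∈ Finset.range N, f n) :=
    hasSum_sum_of_ne_finset_zero fun n hn => by
      simp only [Finset.mem_range] at hn; simp [hf, hn]
  set K := ∑ n ∈ Finset.range N, f n
  have hbound : ∀ n, ‖a n - C * c n‖ ≤ f n + ‖C‖ / 2 * k n := by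
    intro n
    by_cases hn : n < N
    · have : 0 ≤ ‖C‖ / 2 * k n := mul_nonneg (by positivity) (hkpos n)
      simp only [hf, hn, if_true]; linarith
    · have := hN n (not_lt.1 hn)
      rw [Real.norm_of_nonneg (hkpos n)] at this
      simpa [hf, hn] using this
  -- On (0,1) the modulus of (1-x)^(-β) equals (1-x)^(-Re β). The main term C(1-x)^(-β) thus exceeds
  -- the error, at most K plus half its modulus, by an unbounded amount.
  have hmain : ∀ x ∈ Ioo (0 : ℝ) 1, ‖C‖ / 2 * (1 / (1 - x) ^ β.re) ≤ M + K := by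
    intro x hx
    have hx1 : |x| < 1 := by rw [abs_of_pos hx.1]; exact hx.2
    have s1 := hasSum_powerSeries ha.1 ha.tendsto hx1
    have s2 := (hasSum_multichoose β hx.1.le hx.2).mul_left C
    have s3 : HasSum (fun n => k n * x ^ n) (1 / (1 - x) ^ β.re) := by
      have := hasSum_multichoose (β.re : ℂ) hx.1.le hx.2
      rw [← Complex.hasSum_ofReal]
      convert this using 1
      · ext n; rw [hkc]; push_cast; rfl
      · rw [← Complex.ofReal_one, ← Complex.ofReal_sub, Complex.ofReal_div,
          Complex.ofReal_cpow (by linarith [hx.2])]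
    have s4 := s1.sub s2
    have s5 := hfs.add (s3.mul_left (‖C‖ / 2))
    have h1 := tsum_of_norm_bounded s5 (f := fun n => a n * (x : ℂ) ^ n - C * (c n * (x : ℂ) ^ n)) (by
      intro n
      rw [show a n * (x : ℂ) ^ n - C * (c n * (x : ℂ) ^ n) = (a n - C * c n) * (x : ℂ) ^ n by ring,
        norm_mul, norm_pow, Complex.norm_real, Real.norm_of_nonneg hx.1.le]
      have hxn : x ^ n ≤ 1 := pow_le_one₀ hx.1.le hx.2.le
      have hxn0 : 0 ≤ x ^ n := pow_nonneg hx.1.le n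
      have hf0 : 0 ≤ f n := by
        simp only [hf]; split_ifs <;> positivity
      calc _ ≤ (f n + ‖C‖ / 2 * k n) * x ^ n := by gcongr; exact hbound n
        _ = f n * x ^ n + ‖C‖ / 2 * (k n * x ^ n) := by ring
        _ ≤ _ := by
          gcongr
          exact mul_le_of_le_one_right hf0 hxn)
    rw [s4.tsum_eq] at h1
    have h2 : ‖C * (1 / (1 - (x : ℂ)) ^ β)‖ = ‖C‖ * (1 / (1 - x) ^ β.re) := by
      rw [norm_mul, norm_div, norm_one, ← Complex.ofReal_one, ← Complex.ofReal_sub,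
        Complex.norm_cpow_eq_rpow_re_of_pos (by linarith [hx.2])]
    have h3 := norm_sub_norm_le (C * (1 / (1 - (x : ℂ)) ^ β)) (∑' n, a n * (x : ℂ) ^ n)
    rw [norm_sub_rev, h2] at h3
    linarith [hM x hx]
  have hlim : Tendsto (fun x : ℝ => ‖C‖ / 2 * (1 / (1 - x) ^ β.re)) (𝓝[<] 1) atTop := by
    apply Tendsto.const_mul_atTop (half_pos hCn)
    have h1 : Tendsto (fun x : ℝ => 1 - x) (𝓝[<] 1) (𝓝[>] 0) := by
      apply tendsto_nhdsWithin_of_tendsto_nhds_of_eventually_within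
      · have : Tendsto (fun x : ℝ => 1 - x) (𝓝 1) (𝓝 (1 - 1)) :=
          (continuous_const.sub continuous_id).tendsto 1
        rw [sub_self] at this
        exact this.mono_left nhdsWithin_le_nhds
      · filter_upwards [self_mem_nhdsWithin] with x hx
        simpa using hx
    have h2 := (tendsto_rpow_neg_nhdsGT_zero (y := -β.re) (by linarith)).comp h1
    refine h2.congr' ?_
    filter_upwards [self_mem_nhdsWithin] with x hx
    simp only [Function.comp]
    rw [Real.rpow_neg (by simpa using (le_of_lt hx)), one_div]
  obtain ⟨x, hx1, hx2⟩ := ((hlim.eventually_gt_atTop (M + K)).and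
    (Ioo_mem_nhdsLT (zero_lt_one (α := ℝ)))).exists
  exact absurd (hmain x hx2) (not_le.2 hx1)

/-! ### Termwise differentiation and failure of smoothness at 1. -/

/-- The coefficients of the derivative of a power series. -/
def derivCoeff (a : ℕ → ℂ) (n : ℕ) : ℂ := (n + 1) * a (n + 1)

lemma derivCoeff_eventually_ne {a : ℕ → ℂ} (ha : ∀ᶠ n in atTop, a n ≠ 0) :
    ∀ᶠ n in atTop, derivCoeff a n ≠ 0 := by
  filter_upwards [(tendsto_add_atTop_nat 1).eventually ha] with n hn
  exact mul_ne_zero (by exact_mod_cast n.succ_ne_zero) hn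

lemma derivCoeff_tendsto {a : ℕ → ℂ}
    (hr : Tendsto (fun n => a (n + 1) / a n) atTop (𝓝 1)) :
    Tendsto (fun n => derivCoeff a (n + 1) / derivCoeff a n) atTop (𝓝 1) := by
  have h1 : Tendsto (fun n : ℕ => 1 + ((((n : ℝ) + 1)⁻¹ : ℝ) : ℂ)) atTop (𝓝 1) := by
    have := ((Complex.continuous_ofReal.tendsto 0).comp tendsto_inv_natCast_add_one).const_add 1
    simpa using this
  have h2 := h1.mul (hr.comp (tendsto_add_atTop_nat 1))
  rw [mul_one] at h2
  refine h2.congr fun n => ?_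
  have : (n : ℂ) + 1 ≠ 0 := by exact_mod_cast n.succ_ne_zero
  simp only [derivCoeff, Function.comp]
  rw [mul_div_mul_comm]
  congr 1
  push_cast
  field_simp

/-- The new ratio has the additional factor (n+2)/(n+1) = 1 + t n, which raises ρ by 1. The index
shift costs nothing, since (1 + t n) t (n+1) = t n. -/
lemma HasRatioExpansion.derivCoeff {a : ℕ → ℂ} {ρ : ℂ} (ha : HasRatioExpansion a ρ) :
    HasRatioExpansion (derivCoeff a) (ρ + 1) := by
  refine ⟨derivCoeff_eventually_ne ha.1, ?_⟩
  have h1 := ha.2.comp_tendsto (tendsto_add_atTop_nat 1)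
  set t : ℕ → ℝ := fun n => ((n : ℝ) + 1)⁻¹ with ht
  have htpos : ∀ n, 0 < t n := fun n => by simp only [ht]; positivity
  have ht1 : ∀ n, t n ≤ 1 := fun n => by
    simp only [ht]; exact inv_le_one_of_one_le₀ (by linarith [Nat.cast_nonneg (α := ℝ) n])
  have htmono : ∀ n, t (n + 1) ≤ t n := fun n => by
    simp only [ht]; push_cast; exact inv_anti₀ (by positivity) (by linarith)
  have hmul : ∀ n, t n - t (n + 1) = t n * t (n + 1) := fun n => by
    simp only [ht]; push_cast
    have h1 : (n : ℝ) + 1 ≠ 0 := by positivity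
    have h2 : (n : ℝ) + 1 + 1 ≠ 0 := by positivity
    field_simp
    ring
  have h2 : (fun n : ℕ => a (n + 1 + 1) / a (n + 1) - 1 - ρ * (t (n + 1) : ℝ)) =O[atTop]
      fun n => (t n) ^ 2 := by
    refine Asymptotics.IsBigO.trans h1 (Asymptotics.IsBigO.of_bound 1
      (Eventually.of_forall fun n => ?_))
    have := htmono n
    have h3 := htpos (n + 1)
    simp only [Function.comp]
    rw [Real.norm_of_nonneg (by positivity), Real.norm_of_nonneg (by positivity), one_mul]
    change t (n + 1) ^ 2 ≤ t n ^ 2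
    gcongr
  have h3 : (fun n : ℕ => (1 + (t n : ℂ)) * (a (n + 1 + 1) / a (n + 1) - 1 - ρ * (t (n + 1) : ℝ)))
      =O[atTop] fun n => (t n) ^ 2 := by
    have : (fun n : ℕ => 1 + (t n : ℂ)) =O[atTop] fun _ => (1 : ℝ) := by
      refine Asymptotics.IsBigO.of_bound 2 (Eventually.of_forall fun n => ?_)
      refine (norm_add_le _ _).trans ?_
      rw [Complex.norm_real, Real.norm_of_nonneg (htpos n).le, norm_one, norm_one]
      linarith [ht1 n]
    exact (this.mul h2).congr_right fun n => one_mul _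
  refine h3.congr_left fun n => ?_
  have hn : (n : ℂ) + 1 ≠ 0 := by exact_mod_cast n.succ_ne_zero
  have e1 : _root_.derivCoeff a (n + 1) / _root_.derivCoeff a n
      = (1 + (t n : ℂ)) * (a (n + 1 + 1) / a (n + 1)) := by
    simp only [_root_.derivCoeff, ht]
    rw [mul_div_mul_comm]
    congr 1
    push_cast
    field_simp
  rw [e1]
  have e2 : (t n : ℂ) - t (n + 1) = t n * t (n + 1) := by exact_mod_cast hmul n
  change _ = _ - 1 - (ρ + 1) * (t n : ℂ)
  linear_combination (ρ : ℂ) * e2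

lemma hasDerivAt_powerSeries {a : ℕ → ℂ} (ha : ∀ᶠ n in atTop, a n ≠ 0)
    (hr : Tendsto (fun n => a (n + 1) / a n) atTop (𝓝 1)) {x : ℝ} (hx : |x| < 1) :
    HasDerivAt (fun y : ℝ => ∑' n, a n * (y : ℂ) ^ n) (∑' n, derivCoeff a n * (x : ℂ) ^ n) x := by
  obtain ⟨R, hxR, hR1⟩ := exists_between hx
  have hR0 : 0 < R := (abs_nonneg x).trans_lt hxR
  have hs := summable_of_tendsto_ratio (derivCoeff_eventually_ne ha) (derivCoeff_tendsto hr)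
    (x := R) (by rwa [abs_of_pos hR0])
  rw [abs_of_pos hR0] at hs
  have hu : Summable fun n : ℕ => ‖a n‖ * (n * R ^ (n - 1)) := by
    rw [← summable_nat_add_iff 1]
    refine hs.congr fun n => ?_
    rw [derivCoeff, norm_mul, show ‖(n : ℂ) + 1‖ = (n : ℝ) + 1 by
      rw [show (n : ℂ) + 1 = ((n + 1 : ℕ) : ℂ) by push_cast; rfl, Complex.norm_natCast]; simp]
    push_cast
    ring
  have h := hasDerivAt_tsum_of_isPreconnected (𝕜 := ℝ) (t := Ioo (-R) R) (y₀ := 0) (y := x)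
    (g := fun n y => a n * (y : ℂ) ^ n) (g' := fun n y => a n * (n * (y : ℂ) ^ (n - 1))) hu
    isOpen_Ioo isPreconnected_Ioo ?_ ?_ ⟨by linarith, hR0⟩ ?_ (abs_lt.1 hxR)
  · refine h.congr_deriv ?_
    have h2 : Summable fun n : ℕ => a n * (n * (x : ℂ) ^ (n - 1)) := by
      refine Summable.of_norm_bounded hu fun n => ?_
      rw [norm_mul, norm_mul, norm_pow, Complex.norm_natCast, Complex.norm_real, Real.norm_eq_abs]
      gcongr
    rw [h2.tsum_eq_zero_add]
    simp only [Nat.cast_zero, zero_mul, mul_zero, zero_add, Nat.add_sub_cancel]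
    refine tsum_congr fun n => ?_
    rw [derivCoeff]; push_cast; ring
  · intro n y _
    have := ((Complex.ofRealCLM.hasDerivAt (x := y)).pow n).const_mul (a n)
    exact this.congr_deriv (by simp)
  · intro n y hy
    rw [norm_mul, norm_mul, norm_pow, Complex.norm_natCast, Complex.norm_real, Real.norm_eq_abs]
    have : |y| ≤ R := (abs_lt.2 hy).le
    gcongr
  · refine summable_of_ne_finset_zero (s := {0}) fun n hn => ?_
    simp at hn
    simp [hn]

/-- A power series whose coefficient ratios are `1 + ρ / n + O(1 / n²)` does not extend smoothly
to the closed unit interval. -/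
lemma HasRatioExpansion.not_smooth {a : ℕ → ℂ} {ρ : ℂ} (ha : HasRatioExpansion a ρ) :
    ¬ ∃ g : ℝ → ℂ, ContDiffOn ℝ ∞ g (Icc 0 1) ∧
      ∀ x ∈ Ioo (0 : ℝ) 1, g x = ∑' n, a n * (x : ℂ) ^ n := by
  -- After k derivatives the exponent satisfies Re ρ + k > -1, and `not_bounded` applies.
  obtain ⟨k, hk⟩ := exists_nat_gt (-1 - ρ.re)
  induction k generalizing a ρ with
  | zero =>
    rintro ⟨g, hg, hgx⟩
    obtain ⟨M, hM⟩ := isCompact_Icc.exists_bound_of_continuousOn hg.continuousOn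
    refine ha.not_bounded (by simp at hk; linarith) M fun x hx => ?_
    rw [← hgx x hx]
    exact hM x (Ioo_subset_Icc_self hx)
  | succ k ih =>
    rintro ⟨g, hg, hgx⟩
    refine ih ha.derivCoeff (by push_cast at hk; simp; linarith)
      ⟨derivWithin g (Icc 0 1), hg.derivWithin (uniqueDiffOn_Icc zero_lt_one) (by simp), ?_⟩
    intro x hx
    have hx1 : |x| < 1 := by rw [abs_of_pos hx.1]; exact hx.2
    rw [derivWithin_of_mem_nhds (Icc_mem_nhds hx.1 hx.2)]
    have : g =ᶠ[𝓝 x] fun y : ℝ => ∑' n, a n * (y : ℂ) ^ n := by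
      filter_upwards [Ioo_mem_nhds hx.1 hx.2] with y hy using hgx y hy
    rw [this.deriv_eq]
    exact (hasDerivAt_powerSeries ha.1 ha.tendsto hx1).deriv

lemma contDiffOn_powerSeries {a : ℕ → ℂ} (ha : ∀ᶠ n in atTop, a n ≠ 0)
    (hr : Tendsto (fun n => a (n + 1) / a n) atTop (𝓝 1)) :
    ContDiffOn ℝ ∞ (fun x : ℝ => ∑' n, a n * (x : ℂ) ^ n) (Ioo (-1) 1) := by
  rw [contDiffOn_infty]
  intro k
  induction k generalizing a with
  | zero =>
    refine contDiffOn_zero.2 fun x hx => ?_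
    exact (hasDerivAt_powerSeries ha hr (abs_lt.2 hx)).continuousAt.continuousWithinAt
  | succ k ih =>
    rw [show ((k + 1 : ℕ) : WithTop ℕ∞) = (k : WithTop ℕ∞) + 1 by push_cast; rfl,
      contDiffOn_succ_iff_deriv_of_isOpen isOpen_Ioo]
    refine ⟨fun x hx => (hasDerivAt_powerSeries ha hr
      (abs_lt.2 hx)).differentiableAt.differentiableWithinAt, by simp, ?_⟩
    refine (ih (derivCoeff_eventually_ne ha) (derivCoeff_tendsto hr)).congr fun x hx => ?_
    exact (hasDerivAt_powerSeries ha hr (abs_lt.2 hx)).deriv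

/-! ### Uniqueness of the solution smooth at 0. -/

/-- `f` solves `f'' + p f' + q f = 0` on `(0, 1)`. -/
def SolvesLinear (p q : ℝ → ℂ) (f : ℝ → ℂ) : Prop :=
  ∀ x ∈ Ioo (0 : ℝ) 1, DifferentiableAt ℝ f x ∧ DifferentiableAt ℝ (deriv f) x ∧
    deriv (deriv f) x + p x * deriv f x + q x * f x = 0

lemma SolvesLinear.sub_const_mul {p q f h : ℝ → ℂ} (hf : SolvesLinear p q f)
    (hh : SolvesLinear p q h) (c : ℂ) : SolvesLinear p q fun x => f x - c * h x := by
  have hd : ∀ x ∈ Ioo (0 : ℝ) 1, deriv (fun x => f x - c * h x) x = deriv f x - c * deriv h x := by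
    intro x hx
    exact ((hf x hx).1.hasDerivAt.sub ((hh x hx).1.hasDerivAt.const_mul c)).deriv
  intro x hx
  have hev : deriv (fun x => f x - c * h x) =ᶠ[𝓝 x] fun x => deriv f x - c * deriv h x := by
    filter_upwards [Ioo_mem_nhds hx.1 hx.2] with y hy using hd y hy
  have h2 := (hf x hx).2.1.hasDerivAt.sub ((hh x hx).2.1.hasDerivAt.const_mul c)
  refine ⟨(hf x hx).1.sub ((hh x hx).1.const_mul c), ?_, ?_⟩
  · exact hev.differentiableAt_iff.2 h2.differentiableAt
  · rw [hev.deriv_eq, hd x hx]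
    have e := h2.deriv
    rw [show deriv (fun x => deriv f x - c * deriv h x) x = _ from e]
    linear_combination (hf x hx).2.2 - c * (hh x hx).2.2

/-- A solution of a Fuchsian equation at `0` that is smooth up to `0` and vanishes at `0` is
identically zero. -/
lemma SolvesLinear.eq_zero_of_smooth {p q u P : ℝ → ℂ} {γ : ℝ} {κ : ℂ} (hγ : 1 ≤ γ)
    (hp : ∀ x ∈ Ioo (0 : ℝ) 1, p x = (γ / x : ℝ) + P x)
    (hbd : ∀ r < 1, ∃ K : ℝ, ∀ x ∈ Ioo 0 r, ‖P x‖ ≤ K ∧ ‖x * q x‖ ≤ K)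
    (hq : Tendsto (fun x : ℝ => x * q x) (𝓝[>] 0) (𝓝 κ))
    (hu : SolvesLinear p q u) {ε : ℝ} (hε : 0 < ε) (hs : ContDiffOn ℝ ∞ u (Ico 0 ε))
    (hu0 : u 0 = 0) : ∀ x ∈ Ioo (0 : ℝ) 1, u x = 0 := by
  set S := Ico 0 ε with hS
  have hUD : UniqueDiffOn ℝ S := uniqueDiffOn_Ico 0 ε
  have h0S : (0 : ℝ) ∈ S := ⟨le_rfl, hε⟩
  set u1 := derivWithin u S with hu1
  have hs1 : ContDiffOn ℝ ∞ u1 S := hs.derivWithin hUD (by simp)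
  set u2 := derivWithin u1 S with hu2
  have hs2 : ContDiffOn ℝ ∞ u2 S := hs1.derivWithin hUD (by simp)
  have hSn : ∀ x ∈ Ioo 0 ε, S ∈ 𝓝 x := fun x hx => Ico_mem_nhds hx.1 hx.2
  have e1 : ∀ x ∈ Ioo 0 ε, deriv u x = u1 x := fun x hx =>
    (derivWithin_of_mem_nhds (hSn x hx)).symm
  have e2 : ∀ x ∈ Ioo 0 ε, deriv (deriv u) x = u2 x := by
    intro x hx
    rw [hu2, derivWithin_of_mem_nhds (hSn x hx)]
    apply Filter.EventuallyEq.deriv_eq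
    filter_upwards [Ioo_mem_nhds hx.1 hx.2] with y hy using e1 y hy
  have hle : 𝓝[>] (0 : ℝ) ≤ 𝓝[S] 0 := by
    rw [← nhdsWithin_Ioo_eq_nhdsGT hε]
    exact nhdsWithin_mono _ Ioo_subset_Ico_self
  have t0 : Tendsto u (𝓝[>] 0) (𝓝 (u 0)) := (hs.continuousOn 0 h0S).tendsto.mono_left hle
  have t1 : Tendsto u1 (𝓝[>] 0) (𝓝 (u1 0)) := (hs1.continuousOn 0 h0S).tendsto.mono_left hle
  have t2 : Tendsto u2 (𝓝[>] 0) (𝓝 (u2 0)) := (hs2.continuousOn 0 h0S).tendsto.mono_left hle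
  have tx : Tendsto (fun x : ℝ => (x : ℂ)) (𝓝[>] 0) (𝓝 0) := by
    have := Complex.continuous_ofReal.tendsto 0
    exact (by simpa using this : Tendsto (fun x : ℝ => (x : ℂ)) (𝓝 0) (𝓝 0)).mono_left
      nhdsWithin_le_nhds
  have hev1 : ∀ᶠ x : ℝ in 𝓝[>] 0, x ∈ Ioo 0 ε := Ioo_mem_nhdsGT hε
  have hev2 : ∀ᶠ x : ℝ in 𝓝[>] 0, x ∈ Ioo (0 : ℝ) (1 / 2) := Ioo_mem_nhdsGT (by norm_num)
  have txP : Tendsto (fun x : ℝ => (x : ℂ) * P x) (𝓝[>] 0) (𝓝 0) := by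
    obtain ⟨K, hK⟩ := hbd (1 / 2) (by norm_num)
    refine tx.zero_mul_isBoundedUnder_le ?_
    refine isBoundedUnder_of_eventually_le (a := K) ?_
    filter_upwards [hev2] with x hx using (hK x hx).1
  -- Multiplying the equation by x and letting x → 0 gives γ u'(0) + κ u(0) = 0, hence u'(0) = 0.
  have hlim := ((tx.mul t2).add ((txP.const_add (γ : ℂ)).mul t1)).add (hq.mul t0)
  have hzero : (0 : ℂ) * u2 0 + ((γ : ℂ) + 0) * u1 0 + κ * u 0 = 0 := by
    refine tendsto_nhds_unique (hlim.congr' ?_) tendsto_const_nhds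
    filter_upwards [hev1, hev2] with x hx hx2
    have hx1 : x ∈ Ioo (0 : ℝ) 1 := ⟨hx2.1, by linarith [hx2.2]⟩
    have h := (hu x hx1).2.2
    rw [e2 x hx, e1 x hx, hp x hx1] at h
    have hx0 : (x : ℂ) ≠ 0 := by exact_mod_cast hx.1.ne'
    have h3 : (x : ℂ) * ((γ / x : ℝ) : ℂ) = γ := by push_cast; field_simp
    linear_combination (x : ℂ) * h - u1 x * h3
  have hu10 : u1 0 = 0 := by
    rw [hu0] at hzero
    have : (γ : ℂ) ≠ 0 := by exact_mod_cast (by linarith : γ ≠ 0)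
    simpa [this] using hzero
  have tU : Tendsto (fun x : ℝ => u x / (x : ℂ)) (𝓝[>] 0) (𝓝 0) := by
    have hd : HasDerivWithinAt u (u1 0) S 0 :=
      ((hs.differentiableOn (by simp)) 0 h0S).hasDerivWithinAt
    rw [hasDerivWithinAt_iff_tendsto_slope, hu10] at hd
    have hle' : 𝓝[>] (0 : ℝ) ≤ 𝓝[S \ {0}] 0 := by
      rw [← nhdsWithin_Ioo_eq_nhdsGT hε]
      exact nhdsWithin_mono _ fun x hx => ⟨Ioo_subset_Ico_self hx, hx.1.ne'⟩
    refine (hd.mono_left hle').congr fun x => ?_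
    rw [slope_def_module, hu0, sub_zero, sub_zero, Complex.real_smul]
    push_cast
    ring
  -- With v = u' and U = u/x, the singular part of E' is (2/x)(-γ|v|² + ⟨U,v⟩ - |U|²), which is
  -- nonpositive because γ ≥ 1. The remaining terms are bounded by 3K E.
  set E : ℝ → ℝ := fun x => ‖deriv u x‖ ^ 2 + ‖u x / (x : ℂ)‖ ^ 2 with hE
  have tE : Tendsto E (𝓝[>] 0) (𝓝 0) := by
    have h1 : Tendsto (deriv u) (𝓝[>] 0) (𝓝 0) := by
      rw [hu10] at t1
      refine t1.congr' ?_
      filter_upwards [hev1] with x hx using (e1 x hx).symm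
    have := (h1.norm.pow 2).add (tU.norm.pow 2)
    rw [norm_zero, zero_pow two_ne_zero, add_zero] at this
    exact this
  intro y hy
  obtain ⟨r, hyr, hr1⟩ := exists_between hy.2
  obtain ⟨K, hK⟩ := hbd r hr1
  have hderiv : ∀ x ∈ Ioo 0 r, ∃ E', HasDerivAt E E' x ∧ E' ≤ 3 * K * E x := by
    intro x hx
    have hx1 : x ∈ Ioo (0 : ℝ) 1 := ⟨hx.1, hx.2.trans hr1⟩
    have hx0 : (x : ℂ) ≠ 0 := by exact_mod_cast hx.1.ne'
    obtain ⟨d1, d2, hode⟩ := hu x hx1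
    have hU : HasDerivAt (fun x : ℝ => u x / (x : ℂ))
        ((x⁻¹ : ℝ) • (deriv u x - u x / (x : ℂ))) x := by
      have := d1.hasDerivAt.div (Complex.ofRealCLM.hasDerivAt (x := x)) hx0
      refine this.congr_deriv ?_
      simp only [Complex.ofRealCLM_apply, Complex.real_smul]
      push_cast
      field_simp
    refine ⟨_, (d2.hasDerivAt.norm_sq).add hU.norm_sq, ?_⟩
    set v := deriv u x
    set U := u x / (x : ℂ) with hUd
    have hode' : deriv (deriv u) x = (-(γ / x) : ℝ) • v - P x * v - (x * q x) * U := by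
      rw [hp x hx1] at hode
      rw [Complex.real_smul, hUd]
      push_cast at hode ⊢
      field_simp
      field_simp at hode
      linear_combination hode
    obtain ⟨hK1, hK2⟩ := hK x hx
    have hK0 : 0 ≤ K := (norm_nonneg _).trans hK1
    have i1 : inner ℝ v (P x * v) ≥ -(K * ‖v‖ ^ 2) := by
      have := abs_real_inner_le_norm v (P x * v)
      rw [norm_mul] at this
      have h5 := (abs_le.1 this).1
      have h6 : ‖P x‖ * ‖v‖ ^ 2 ≤ K * ‖v‖ ^ 2 := by gcongr
      nlinarith
    have i2 : inner ℝ v ((x * q x) * U) ≥ -(K * (‖v‖ * ‖U‖)) := by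
      have := abs_real_inner_le_norm v ((x * q x) * U)
      rw [norm_mul] at this
      have h5 := (abs_le.1 this).1
      have h6 : ‖(x : ℂ) * q x‖ * (‖v‖ * ‖U‖) ≤ K * (‖v‖ * ‖U‖) := by gcongr
      nlinarith
    have i3 : inner ℝ U v ≤ ‖U‖ * ‖v‖ := real_inner_le_norm U v
    have hxinv : 0 < x⁻¹ := inv_pos.2 hx.1
    rw [hode', inner_sub_right, inner_sub_right, real_inner_smul_right, real_inner_smul_right,
      inner_sub_right, real_inner_self_eq_norm_sq, real_inner_self_eq_norm_sq]
    have j1 : x⁻¹ * (inner ℝ U v - ‖U‖ ^ 2) ≤ x⁻¹ * (‖v‖ ^ 2 / 4) := by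
      gcongr
      nlinarith [sq_nonneg (‖U‖ - ‖v‖ / 2)]
    have j2 : -(γ / x) * ‖v‖ ^ 2 ≤ -(x⁻¹ * ‖v‖ ^ 2) := by
      have : x⁻¹ * ‖v‖ ^ 2 * 1 ≤ x⁻¹ * ‖v‖ ^ 2 * γ := by gcongr
      have e : -(γ / x) * ‖v‖ ^ 2 = -(x⁻¹ * ‖v‖ ^ 2 * γ) := by rw [div_eq_mul_inv]; ring
      linarith
    have j3 : 0 ≤ x⁻¹ * ‖v‖ ^ 2 := by positivity
    have j4 : K * (‖v‖ * ‖U‖) ≤ K * ((‖v‖ ^ 2 + ‖U‖ ^ 2) / 2) := by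
      gcongr
      nlinarith [sq_nonneg (‖v‖ - ‖U‖)]
    have j5 : 0 ≤ K * ‖v‖ ^ 2 := by positivity
    have j6 : 0 ≤ K * ‖U‖ ^ 2 := by positivity
    change _ ≤ 3 * K * (‖v‖ ^ 2 + ‖U‖ ^ 2)
    linarith
  -- Grönwall: G is antitone and tends to 0 at 0, hence G ≤ 0.
  set G : ℝ → ℝ := fun x => Real.exp (-(3 * K * x)) * E x with hG
  have hGd : ∀ x ∈ Ioo 0 r, ∃ G', HasDerivAt G G' x ∧ G' ≤ 0 := by
    intro x hx
    obtain ⟨E', hE', hle⟩ := hderiv x hx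
    have h1 : HasDerivAt (fun x : ℝ => -(3 * K * x)) (-(3 * K)) x :=
      (((hasDerivAt_id x).const_mul (3 * K)).neg).congr_deriv (by simp)
    refine ⟨_, h1.exp.mul hE', ?_⟩
    have := mul_le_mul_of_nonneg_left hle (Real.exp_pos (-(3 * K * x))).le
    linarith
  have hanti : AntitoneOn G (Ioo 0 r) := by
    refine antitoneOn_of_deriv_nonpos (convex_Ioo 0 r) ?_ ?_ ?_
    · intro x hx
      obtain ⟨_, h, _⟩ := hGd x hx
      exact h.continuousAt.continuousWithinAt
    · rw [interior_Ioo]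
      intro x hx
      obtain ⟨_, h, _⟩ := hGd x hx
      exact h.differentiableAt.differentiableWithinAt
    · rw [interior_Ioo]
      intro x hx
      obtain ⟨_, h, h2⟩ := hGd x hx
      rwa [h.deriv]
  have tG : Tendsto G (𝓝[>] 0) (𝓝 0) := by
    have h1 : Tendsto (fun x : ℝ => Real.exp (-(3 * K * x))) (𝓝[>] 0) (𝓝 1) := by
      have : Continuous fun x : ℝ => Real.exp (-(3 * K * x)) := by fun_prop
      have := this.tendsto 0
      simp only [mul_zero, neg_zero, Real.exp_zero] at this
      exact this.mono_left nhdsWithin_le_nhds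
    simpa using h1.mul tE
  have hGy : G y ≤ 0 := by
    refine ge_of_tendsto tG ?_
    filter_upwards [Ioo_mem_nhdsGT hy.1] with x hx
    exact hanti ⟨hx.1, hx.2.trans hyr⟩ ⟨hy.1, hyr⟩ hx.2.le
  have hEy : E y ≤ 0 := by
    by_contra hcon
    exact absurd hGy (not_le.2 (mul_pos (Real.exp_pos _) (not_le.1 hcon)))
  have hUy : ‖u y / (y : ℂ)‖ ^ 2 ≤ 0 := by
    have : 0 ≤ ‖deriv u y‖ ^ 2 := by positivity
    simp only [hE] at hEy
    linarith
  have hy0 : (y : ℂ) ≠ 0 := by exact_mod_cast hy.1.ne'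
  have h1 : ‖u y / (y : ℂ)‖ = 0 := by
    have := sq_nonneg ‖u y / (y : ℂ)‖
    exact pow_eq_zero_iff (two_ne_zero) |>.1 (le_antisymm hUy this)
  rw [norm_eq_zero, div_eq_zero_iff] at h1
  exact h1.resolve_right hy0

/-! ### From the recurrence to the differential equation. -/

namespace IsHeunSeq

variable {D γ : ℝ} {δ ε q₀ q₁ : ℂ} {a : ℕ → ℂ}

/-- All series are reindexed to powers x^(n+1), whose coefficients cancel by `step`; the constant
coefficient left over cancels by `one`. -/
lemma polynomial_ode (ha : IsHeunSeq D γ δ ε q₀ q₁ a) {x : ℝ} {H0 H1 H2 : ℂ}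
    (h0 : HasSum (fun n => a n * (x : ℂ) ^ n) H0)
    (h1 : HasSum (fun n => derivCoeff a n * (x : ℂ) ^ n) H1)
    (h2 : HasSum (fun n => derivCoeff (derivCoeff a) n * (x : ℂ) ^ n) H2) :
    4 * x * (x - 1) * (D + x) * H2
      + (4 * γ * (x - 1) * (D + x) + 4 * δ * x * (D + x) + 4 * ε * x * (x - 1)) * H1
      + (q₀ + q₁ * x) * H0 = 0 := by
  have s1 := h2.mul_left (-4 * D * x : ℂ)
  have s2 : HasSum (fun n : ℕ => 4 * (D - 1) * ((n : ℂ) * (n + 1)) * a (n + 1) * (x : ℂ) ^ (n + 1))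
      (4 * (D - 1) * x ^ 2 * H2) := by
    have := (hasSum_nat_add_iff (f := fun n : ℕ => 4 * (D - 1) * ((n : ℂ) * (n + 1)) * a (n + 1)
      * (x : ℂ) ^ (n + 1)) 1 (g := 4 * (D - 1) * x ^ 2 * H2)).1 (by
        refine (h2.mul_left (4 * (D - 1) * x ^ 2 : ℂ)).congr_fun ?_
        intro n; simp only [derivCoeff]; push_cast; ring)
    simpa using this
  have s3 : HasSum (fun n : ℕ => 4 * ((n : ℂ) * (n - 1)) * a n * (x : ℂ) ^ (n + 1))
      (4 * x ^ 3 * H2) := by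
    have := (hasSum_nat_add_iff (f := fun n : ℕ => 4 * ((n : ℂ) * (n - 1)) * a n
      * (x : ℂ) ^ (n + 1)) 2 (g := 4 * x ^ 3 * H2)).1 (by
        refine (h2.mul_left (4 * x ^ 3 : ℂ)).congr_fun ?_
        intro n; simp only [derivCoeff]; push_cast; ring)
    simpa [Finset.sum_range_succ] using this
  have s4 := ((hasSum_nat_add_iff' 1).2 h1).mul_left (-4 * γ * D : ℂ)
  have s5 := h1.mul_left ((4 * γ * (D - 1) + 4 * δ * D - 4 * ε) * x)
  have s6 : HasSum (fun n : ℕ => (4 * γ + 4 * δ + 4 * ε) * n * a n * (x : ℂ) ^ (n + 1))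
      ((4 * γ + 4 * δ + 4 * ε) * x ^ 2 * H1) := by
    have := (hasSum_nat_add_iff (f := fun n : ℕ => (4 * γ + 4 * δ + 4 * ε) * n * a n
      * (x : ℂ) ^ (n + 1)) 1 (g := (4 * γ + 4 * δ + 4 * ε) * x ^ 2 * H1)).1 (by
        refine (h1.mul_left ((4 * γ + 4 * δ + 4 * ε) * x ^ 2)).congr_fun ?_
        intro n; simp only [derivCoeff]; push_cast; ring)
    simpa using this
  have s7 := ((hasSum_nat_add_iff' 1).2 h0).mul_left q₀
  have s8 := h0.mul_left (q₁ * x)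
  have total := ((((((s1.add s2).add s3).add s4).add s5).add s6).add s7).add s8
  have hz := total.unique (hasSum_zero.congr_fun fun n => by
    have := ha.step n
    simp only [derivCoeff]
    push_cast at this ⊢
    linear_combination (-(x : ℂ) ^ (n + 1)) * this)
  have h1' := ha.one
  simp [derivCoeff] at hz
  push_cast at h1'
  linear_combination hz - h1'

end IsHeunSeq

lemma quadratic_quotient_expansion {D γ : ℝ} (hD : 0 < D) (hγ : 0 ≤ γ) (c p q : ℂ) :
    ∃ α : ℂ, (fun n : ℕ => (4 * c * n ^ 2 + p * n + q) / (((4 * (n + 2) * (n + 1 + γ) : ℝ) : ℂ) * D)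
      - c / D - α * (((n : ℝ) + 1)⁻¹ : ℝ)) =O[atTop] fun n : ℕ => (((n : ℝ) + 1)⁻¹) ^ 2 := by
  -- P n + Q is the remainder of the numerator after subtracting 4c(n+2)(n+1+γ).
  set P : ℂ := p - 4 * c * (3 + γ) with hP
  set Q : ℂ := q - 8 * c * (1 + γ) with hQ
  refine ⟨P / (4 * D), ?_⟩
  set u : ℂ := P + Q - P * (3 + γ)
  set w : ℂ := Q - 2 * P * (1 + γ)
  refine Asymptotics.IsBigO.of_bound ((‖u‖ + ‖w‖) / (4 * D)) (Eventually.of_forall fun n => ?_)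
  have hDc : (D : ℂ) ≠ 0 := by exact_mod_cast hD.ne'
  have h1 : (n : ℂ) + 1 ≠ 0 := by exact_mod_cast n.succ_ne_zero
  have h2 : (n : ℂ) + 2 ≠ 0 := by exact_mod_cast (n + 1).succ_ne_zero
  have h3 : (n : ℂ) + 1 + γ ≠ 0 := by
    have : ((n : ℝ) + 1 + γ) ≠ 0 := by positivity
    exact_mod_cast this
  have key : (4 * c * n ^ 2 + p * n + q) / (((4 * (n + 2) * (n + 1 + γ) : ℝ) : ℂ) * D)
      - c / D - P / (4 * D) * (((n : ℝ) + 1)⁻¹ : ℝ)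
      = (u * n + w) / ((4 * D * ((n + 2) * (n + 1 + γ) * (n + 1)) : ℝ) : ℂ) := by
    simp only [u, w, hP, hQ]
    push_cast
    field_simp
    ring
  rw [key, norm_div, Complex.norm_real, Real.norm_of_nonneg (by positivity),
    Real.norm_of_nonneg (by positivity)]
  have hn : (0 : ℝ) ≤ n := Nat.cast_nonneg n
  have h4 : ‖u * n + w‖ ≤ (‖u‖ + ‖w‖) * (n + 1) := by
    refine (norm_add_le _ _).trans ?_
    rw [norm_mul, Complex.norm_natCast]
    nlinarith [norm_nonneg u, norm_nonneg w, mul_nonneg (norm_nonneg w) hn]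
  rw [div_mul_eq_mul_div, div_le_div_iff₀ (by positivity) (by positivity), inv_pow,
    ← div_eq_mul_inv, div_mul_eq_mul_div, le_div_iff₀ (by positivity)]
  have h5 : ((n : ℝ) + 1) ^ 2 ≤ (n + 2) * (n + 1 + γ) := by nlinarith
  calc ‖u * n + w‖ * (4 * D) * ((n : ℝ) + 1) ^ 2
      ≤ ((‖u‖ + ‖w‖) * (n + 1)) * (4 * D) * ((n + 2) * (n + 1 + γ)) := by gcongr
    _ = _ := by ring

namespace IsHeunSeq

variable {D γ : ℝ} {δ ε q₀ q₁ : ℂ} {a : ℕ → ℂ}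

lemma exists_hasRatioExpansion (ha : IsHeunSeq D γ δ ε q₀ q₁ a) (hD : 2 ≤ D) (hγ : 0 ≤ γ)
    (hne : ∀ᶠ n in atTop, a n ≠ 0) {e : ℕ → ℂ} (he : Tendsto e atTop (𝓝 (1 / 2)))
    (hre : ∀ᶠ n in atTop, 1 / 8 ≤ (e n * (a (n + 1) / a n)).re) :
    ∃ ρ, HasRatioExpansion a ρ := by
  have hD0 : 0 < D := by linarith
  have hDc : (D : ℂ) ≠ 0 := by exact_mod_cast hD0.ne'
  obtain ⟨α, hα⟩ := quadratic_quotient_expansion hD0 hγ (D - 1 : ℂ)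
    (4 * (D - 1) + (4 * γ * (D - 1) + 4 * δ * D - 4 * ε))
    ((4 * γ * (D - 1) + 4 * δ * D - 4 * ε) + q₀)
  obtain ⟨β, hβ⟩ := quadratic_quotient_expansion hD0 hγ 1 (-4 + (4 * γ + 4 * δ + 4 * ε)) q₁
  have hb1 : 1 / D ≤ 1 / 2 := one_div_le_one_div_of_le two_pos hD
  have hrec : ∀ᶠ n : ℕ in atTop, a (n + 1 + 1) / a (n + 1)
      = (4 * (D - 1 : ℂ) * n ^ 2 + (4 * (D - 1) + (4 * γ * (D - 1) + 4 * δ * D - 4 * ε)) * n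
          + ((4 * γ * (D - 1) + 4 * δ * D - 4 * ε) + q₀))
          / (((4 * (n + 2) * (n + 1 + γ) : ℝ) : ℂ) * D)
        + (4 * 1 * n ^ 2 + (-4 + (4 * γ + 4 * δ + 4 * ε)) * n + q₁)
          / (((4 * (n + 2) * (n + 1 + γ) : ℝ) : ℂ) * D) / (a (n + 1) / a n) := by
    filter_upwards [hne, (tendsto_add_atTop_nat 1).eventually hne] with n h1 h2
    have h3 := ha.step n
    have h4 : ((4 * (n + 2) * (n + 1 + γ) : ℝ) : ℂ) * D ≠ 0 := by
      refine mul_ne_zero ?_ hDc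
      rw [Complex.ofReal_ne_zero]
      positivity
    generalize ((4 * (n + 2) * (n + 1 + γ) : ℝ) : ℂ) * D = X at *
    have h5 : a (n + 1 + 1) = ((4 * (D - 1) * n * (n + 1)
        + (4 * γ * (D - 1) + 4 * δ * D - 4 * ε) * (n + 1) + q₀) * a (n + 1)
      + (4 * n * (n - 1) + (4 * γ + 4 * δ + 4 * ε) * n + q₁) * a n) / X := by
      rw [← h3, mul_div_cancel_left₀ _ h4]
    rw [h5]
    field_simp
    ring
  obtain ⟨ρ, hρ⟩ := exists_ratio_expansion (r := fun n => a (n + 1) / a n) (b := 1 / D)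
    (α := α) (β := β) (c := 1 / 8) (by positivity) hb1 (by norm_num)
    (hα.congr_left fun n => by
      rw [show ((1 - 1 / D : ℝ) : ℂ) = ((D : ℂ) - 1) / D by push_cast; field_simp])
    (hβ.congr_left fun n => by rw [show ((1 / D : ℝ) : ℂ) = 1 / (D : ℂ) by push_cast; rfl])
    he hrec hre
  exact ⟨ρ, hne, hρ⟩

/-- All qualitative properties of a Heun power series whose coefficient ratios asymptotically lie in
a half-plane. -/
lemma properties (ha : IsHeunSeq D γ δ ε q₀ q₁ a) (hD : 2 ≤ D) (hγ : 1 ≤ γ)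
    (h : (∀ᶠ n in atTop, a n ≠ 0) ∧ ∃ e : ℕ → ℂ, Tendsto e atTop (𝓝 (1 / 2)) ∧
      ∀ᶠ n in atTop, 1 / 8 ≤ (e n * (a (n + 1) / a n)).re)
    {p q : ℝ → ℂ} (hp : ∀ x : ℝ, p x = γ / (x : ℂ) + δ / (x - 1) + ε / (D + x))
    (hq : ∀ x : ℝ, q x = (q₀ + q₁ * x) / (4 * x * (x - 1) * (D + x))) :
    (∀ᶠ n : ℕ in atTop, a n ≠ 0) ∧
    Tendsto (fun n => a (n + 1) / a n) atTop (𝓝 1) ∧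
    (FormalMultilinearSeries.ofScalars ℂ a).radius = 1 ∧
    SolvesLinear p q (fun x => ∑' n, a n * (x : ℂ) ^ n) ∧
    (∀ f : ℝ → ℂ, SolvesLinear p q f → (∃ ε : ℝ, 0 < ε ∧ ContDiffOn ℝ ∞ f (Ico 0 ε)) →
      ∃ c : ℂ, ∀ x ∈ Ico (0 : ℝ) 1, f x = c * ∑' n, a n * (x : ℂ) ^ n) ∧
    (¬ ∃ g : ℝ → ℂ, ContDiffOn ℝ ∞ g (Icc 0 1) ∧
      ∀ x ∈ Ico (0 : ℝ) 1, g x = ∑' n, a n * (x : ℂ) ^ n) := by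
  obtain ⟨hne, e, he, hre⟩ := h
  have hD0 : 0 < D := by linarith
  obtain ⟨ρ, hρ⟩ := ha.exists_hasRatioExpansion hD (by linarith) hne he hre
  have ht := hρ.tendsto
  have habs : ∀ x ∈ Ioo (0 : ℝ) 1, |x| < 1 := fun x hx => by rw [abs_of_pos hx.1]; exact hx.2
  have hne' := derivCoeff_eventually_ne hne
  have ht' := derivCoeff_tendsto ht
  have hsol : SolvesLinear p q (fun x => ∑' n, a n * (x : ℂ) ^ n) := by
    intro x hx
    have d1 : ∀ y ∈ Ioo (0 : ℝ) 1, deriv (fun x : ℝ => ∑' n, a n * (x : ℂ) ^ n) y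
        = ∑' n, derivCoeff a n * (y : ℂ) ^ n :=
      fun y hy => (hasDerivAt_powerSeries hne ht (habs y hy)).deriv
    have hev : deriv (fun x : ℝ => ∑' n, a n * (x : ℂ) ^ n)
        =ᶠ[𝓝 x] fun y : ℝ => ∑' n, derivCoeff a n * (y : ℂ) ^ n := by
      filter_upwards [Ioo_mem_nhds hx.1 hx.2] with y hy using d1 y hy
    have h2 := hasDerivAt_powerSeries hne' ht' (habs x hx)
    refine ⟨(hasDerivAt_powerSeries hne ht (habs x hx)).differentiableAt,
      hev.differentiableAt_iff.2 h2.differentiableAt, ?_⟩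
    rw [hev.deriv_eq, h2.deriv, d1 x hx]
    have hpoly := ha.polynomial_ode (hasSum_powerSeries hne ht (habs x hx))
      (hasSum_powerSeries hne' ht' (habs x hx))
      (hasSum_powerSeries (derivCoeff_eventually_ne hne') (derivCoeff_tendsto ht') (habs x hx))
    have n1 : (x : ℂ) ≠ 0 := by exact_mod_cast hx.1.ne'
    have n2 : (x : ℂ) - 1 ≠ 0 := by
      have : x - 1 ≠ 0 := by linarith [hx.2]
      exact_mod_cast this
    have n3 : (D : ℂ) + x ≠ 0 := by
      have : D + x ≠ 0 := by linarith [hx.1]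
      exact_mod_cast this
    rw [hp, hq]
    beta_reduce
    generalize (∑' n, a n * (x : ℂ) ^ n) = H0 at *
    generalize (∑' n, derivCoeff a n * (x : ℂ) ^ n) = H1 at *
    generalize (∑' n, derivCoeff (derivCoeff a) n * (x : ℂ) ^ n) = H2 at *
    have : H2 + (γ / (x : ℂ) + δ / (x - 1) + ε / (D + x)) * H1
        + (q₀ + q₁ * x) / (4 * x * (x - 1) * (D + x)) * H0
        = (4 * x * (x - 1) * (D + x) * H2
          + (4 * γ * (x - 1) * (D + x) + 4 * δ * x * (D + x) + 4 * ε * x * (x - 1)) * H1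
          + (q₀ + q₁ * x) * H0) / (4 * x * (x - 1) * (D + x)) := by
      field_simp
    rw [this, hpoly, zero_div]
  refine ⟨hne, ht, ?_, hsol, ?_, ?_⟩
  · have := FormalMultilinearSeries.ofScalars_radius_eq_inv_of_tendsto (r := 1) ℂ a one_ne_zero
      (by simpa using ht.norm)
    simpa using this
  · rintro f hf ⟨η, hη, hfs⟩
    -- The constant is f(0) because h(0) = 1.
    refine ⟨f 0, ?_⟩
    have hH0 : (∑' n, a n * ((0 : ℝ) : ℂ) ^ n) = 1 := by
      rw [tsum_eq_single 0 fun n hn => by simp [hn]]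
      simp [ha.zero]
    set u : ℝ → ℂ := fun x => f x - f 0 * ∑' n, a n * (x : ℂ) ^ n with hu
    have hus := hf.sub_const_mul hsol (f 0)
    have hu0 : u 0 = 0 := by simp only [hu, hH0]; ring
    have husm : ContDiffOn ℝ ∞ u (Ico 0 (min η 1)) := by
      refine (hfs.mono fun x hx => ⟨hx.1, hx.2.trans_le (min_le_left _ _)⟩).sub
        (contDiffOn_const.mul ((contDiffOn_powerSeries hne ht).mono fun x hx =>
          ⟨by linarith [hx.1], hx.2.trans_le (min_le_right _ _)⟩))
    -- The value κ = -q₀/(4D) is the limit of x q(x) at 0.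
    have hzero := hus.eq_zero_of_smooth (P := fun x => δ / (x - 1) + ε / (D + x)) (κ := -q₀ / (4 * D))
      hγ ?_ ?_ ?_ (lt_min hη one_pos) husm hu0
    · intro x hx
      rcases hx.1.eq_or_lt with h0 | h0
      · rw [← h0, hH0, mul_one]
      · exact sub_eq_zero.1 (hzero x ⟨h0, hx.2⟩)
    · intro x _
      rw [hp]; push_cast; ring
    · intro r hr
      refine ⟨max (‖δ‖ / (1 - r) + ‖ε‖ / D) ((‖q₀‖ + ‖q₁‖) / (4 * (1 - r) * D)), fun x hx => ?_⟩
      have hx0 : (x : ℂ) ≠ 0 := by exact_mod_cast hx.1.ne'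
      have m1 : 1 - r ≤ ‖(x : ℂ) - 1‖ := by
        rw [← Complex.ofReal_one, ← Complex.ofReal_sub, Complex.norm_real, Real.norm_eq_abs,
          abs_sub_comm]
        exact le_trans (by linarith [hx.2]) (le_abs_self _)
      have m2 : D ≤ ‖(D : ℂ) + x‖ := by
        rw [← Complex.ofReal_add, Complex.norm_real]
        exact le_trans (by linarith [hx.1]) (le_abs_self _)
      have hr' : 0 < 1 - r := by linarith
      constructor
      · refine le_trans ?_ (le_max_left _ _)
        refine (norm_add_le _ _).trans ?_
        rw [norm_div, norm_div]
        gcongr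
      · refine le_trans ?_ (le_max_right _ _)
        have : (x : ℂ) * q x = (q₀ + q₁ * x) / (4 * (x - 1) * (D + x)) := by
          rw [hq, mul_div_assoc', show (4 * x * (x - 1) * (D + x) : ℂ)
            = x * (4 * (x - 1) * (D + x)) by ring, mul_div_mul_left _ _ hx0]
        rw [this, norm_div, norm_mul, norm_mul]
        have m3 : ‖q₀ + q₁ * x‖ ≤ ‖q₀‖ + ‖q₁‖ := by
          refine (norm_add_le _ _).trans ?_
          rw [norm_mul, Complex.norm_real, Real.norm_of_nonneg hx.1.le]
          have : ‖q₁‖ * x ≤ ‖q₁‖ * 1 := by gcongr; linarith [hx.2]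
          linarith
        have m4 : ‖(4 : ℂ)‖ = 4 := by simp
        rw [m4]
        gcongr
    · have hcont : ContinuousAt (fun x : ℝ => (q₀ + q₁ * (x : ℂ)) / (4 * ((x : ℂ) - 1) * (D + x))) 0 := by
        have hDc : (D : ℂ) ≠ 0 := by exact_mod_cast hD0.ne'
        refine ContinuousAt.div (by fun_prop) (by fun_prop) ?_
        simp [hDc]
      have := hcont.tendsto.mono_left (nhdsWithin_le_nhds (s := Ioi 0))
      have hval : (q₀ + q₁ * ((0 : ℝ) : ℂ)) / (4 * (((0 : ℝ) : ℂ) - 1) * (D + ((0 : ℝ) : ℂ)))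
          = -q₀ / (4 * D) := by
        simp [neg_div, div_neg]
      rw [hval] at this
      refine this.congr' ?_
      filter_upwards [self_mem_nhdsWithin] with x hx
      have hx0 : (x : ℂ) ≠ 0 := by exact_mod_cast (ne_of_gt hx)
      rw [hq, mul_div_assoc', show (4 * x * (x - 1) * (D + x) : ℂ)
        = x * (4 * (x - 1) * (D + x)) by ring, mul_div_mul_left _ _ hx0]
  · rintro ⟨g, hg, hgx⟩
    exact hρ.not_smooth ⟨g, hg, fun x hx => hgx x (Ioo_subset_Ico_self hx)⟩

end IsHeunSeq

/-! ### Matching the explicit coefficients and conclusion. -/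

/-- Integer indices let the instance n = -1 of `hA`, where n+1 = 0 and n+2 = 1, supply the initial
relation `one`. -/
lemma isHeunSeq_heunCoeff {d l : ℕ} {m : ℤ} {z : ℂ} {D γ : ℝ} {δ ε q₀ q₁ : ℂ}
    (hA : ∀ n : ℤ, -1 ≤ n → 4 * ((n : ℂ) + 2) * (n + 1 + γ) * D * coeffA d l m n z
      = 4 * (D - 1) * n * (n + 1) + (4 * γ * (D - 1) + 4 * δ * D - 4 * ε) * (n + 1) + q₀)
    (hB : ∀ n : ℤ, -1 ≤ n → 4 * ((n : ℂ) + 2) * (n + 1 + γ) * D * coeffB d l m n z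
      = 4 * n * (n - 1) + (4 * γ + 4 * δ + 4 * ε) * n + q₁) :
    IsHeunSeq D γ δ ε q₀ q₁ (heunCoeff d l m z) where
  zero := by rw [heunCoeff]
  one := by
    have := hA (-1) le_rfl
    rw [heunCoeff, heunCoeff]
    push_cast at this ⊢
    linear_combination this
  step n := by
    have h1 := hA n (by omega)
    have h2 := hB n (by omega)
    rw [heunCoeff]
    push_cast at h1 h2 ⊢
    linear_combination heunCoeff d l m z (n + 1) * h1 + heunCoeff d l m z n * h2

lemma heun_denominator_ne_zero {d : ℕ} (hd : 4 ≤ d) {n k : ℤ} (hn : -1 ≤ n) (hk : 0 < k) {w : ℂ}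
    (hw : w = k) : 2 * ((d : ℂ) - 2) * ((n : ℂ) + 2) * w ≠ 0 := by
  have h1 : (d : ℂ) - 2 ≠ 0 := by
    have : (d : ℤ) - 2 ≠ 0 := by omega
    exact_mod_cast this
  have h2 : (n : ℂ) + 2 ≠ 0 := by
    have : n + 2 ≠ 0 := by omega
    exact_mod_cast this
  have h3 : w ≠ 0 := by rw [hw]; exact_mod_cast hk.ne'
  exact mul_ne_zero (mul_ne_zero (mul_ne_zero two_ne_zero h1) h2) h3

section Cases

variable {d l : ℕ} {m : ℤ} (z : ℂ)

lemma isHeunSeq_of_l_one_of_m_max (hd : 4 ≤ d) (h : l = 1 ∧ m = (d : ℤ) - 1) {D : ℝ}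
    (hD : D = d - 2) :
    IsHeunSeq D (D / 2 + 3) ((2 * z + 1 - D) / 2) 0 (D * z ^ 2 + 5 * D * z + 2 * D - 4)
      ((z + 2) * (z + 3)) (heunCoeff d l m z) := by
  subst hD
  apply isHeunSeq_heunCoeff <;> intro n hn
  all_goals
    have hden := heun_denominator_ne_zero hd hn (k := 2 * n + d + 6) (by omega)
      (w := 2 * (n : ℂ) + d + 6) (by push_cast; ring)
    first
    | rw [coeffA, if_pos h, mul_div_assoc', div_eq_iff hden]
    | rw [coeffB, if_pos h, mul_div_assoc', div_eq_iff hden]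
    push_cast
    ring

lemma isHeunSeq_of_l_one_of_m_one (hd : 4 ≤ d) (h1 : ¬(l = 1 ∧ m = (d : ℤ) - 1))
    (h : l = 1 ∧ m = 1) {D : ℝ} (hD : D = d - 2) :
    IsHeunSeq D (D / 2 + 3) ((2 * z + 1 - D) / 2) 0 (D * z ^ 2 + 5 * D * z + 4 * D - 4)
      ((z + 1) * (z + 4)) (heunCoeff d l m z) := by
  subst hD
  apply isHeunSeq_heunCoeff <;> intro n hn
  all_goals
    have hden := heun_denominator_ne_zero hd hn (k := 2 * n + d + 6) (by omega)
      (w := 2 * (n : ℂ) + d + 6) (by push_cast; ring)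
    first
    | rw [coeffA, if_neg h1, if_pos h, mul_div_assoc', div_eq_iff hden]
    | rw [coeffB, if_neg h1, if_pos h, mul_div_assoc', div_eq_iff hden]
    push_cast
    ring

lemma isHeunSeq_of_l_two_of_m_max (hd : 4 ≤ d) (h1 : ¬(l = 1 ∧ m = (d : ℤ) - 1))
    (h2 : ¬(l = 1 ∧ m = 1)) (h : l = 2 ∧ m = (d : ℤ)) {D : ℝ} (hD : D = d - 2) :
    IsHeunSeq D (D / 2 + 4) ((2 * z + 1 - D) / 2) 0 (D * z ^ 2 + 7 * D * z + 8 * D - 8)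
      ((z + 3) * (z + 4)) (heunCoeff d l m z) := by
  subst hD
  apply isHeunSeq_heunCoeff <;> intro n hn
  all_goals
    have hden := heun_denominator_ne_zero hd hn (k := 2 * n + d + 8) (by omega)
      (w := 2 * (n : ℂ) + d + 8) (by push_cast; ring)
    first
    | rw [coeffA, if_neg h1, if_neg h2, if_pos h, mul_div_assoc', div_eq_iff hden]
    | rw [coeffB, if_neg h1, if_neg h2, if_pos h, mul_div_assoc', div_eq_iff hden]
    push_cast
    ring

lemma isHeunSeq_of_generic (hd : 4 ≤ d) (h1 : ¬(l = 1 ∧ m = (d : ℤ) - 1))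
    (h2 : ¬(l = 1 ∧ m = 1)) (h3 : ¬(l = 2 ∧ m = (d : ℤ))) {D : ℝ} (hD : D = d - 2) :
    IsHeunSeq D (D / 2 + 1 + (l : ℝ)) ((2 * z + 1 - D) / 2) (-2)
      (D * ((l : ℝ) : ℂ) ^ 2 + (D + 4) * ((l : ℝ) : ℂ) + D * z * (2 * ((l : ℝ) : ℂ) + z + 1) - 2 * D
        - 4 * ((m : ℝ) : ℂ))
      ((z + ((l : ℝ) : ℂ) - 1) * (z + ((l : ℝ) : ℂ) - 2)) (heunCoeff d l m z) := by
  subst hD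
  apply isHeunSeq_heunCoeff <;> intro n hn
  all_goals
    have hden := heun_denominator_ne_zero hd hn (k := 2 * n + 2 * l + d + 2) (by omega)
      (w := 2 * (n : ℂ) + 2 * l + d + 2) (by push_cast; ring)
    first
    | rw [coeffA, if_neg h1, if_neg h2, if_neg h3, mul_div_assoc', div_eq_iff hden]
    | rw [coeffB, if_neg h1, if_neg h2, if_neg h3, mul_div_assoc', div_eq_iff hden]
    push_cast
    ring

end Cases

theorem mainTheorem3 (d l : ℕ) (hd : 4 ≤ d) (hl : 1 ≤ l) (m : ℤ)
    (hm : m = -(l : ℤ) ∨ m = 1 ∨ m = (l : ℤ) + (d : ℤ) - 2)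
    (z : ℂ) (hz : 0 ≤ z.re) :
    -- the ratios are eventually well defined and converge to 1
    (∀ᶠ n : ℕ in atTop, heunCoeff d l m z n ≠ 0) ∧
    Tendsto (heunRatio d l m z) atTop (𝓝 1) ∧
    -- the Heun series has radius of convergence 1
    (FormalMultilinearSeries.ofScalars ℂ (heunCoeff d l m z)).radius = 1 ∧
    -- its sum solves the Heun equation on (0,1) ...
    SolvesHeun d l m z (heunSeries d l m z) ∧
    -- ... and is, up to a constant factor, the only solution that is smooth at 0
    (∀ f : ℝ → ℂ, SolvesHeun d l m z f →
      (∃ ε : ℝ, 0 < ε ∧ ContDiffOn ℝ ∞ f (Ico 0 ε)) →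
      ∃ c : ℂ, ∀ x ∈ Ico (0 : ℝ) 1, f x = c * heunSeries d l m z x) ∧
    -- it is not smooth on [0,1]: no smooth function on [0,1] coincides with it on [0,1)
    (¬ ∃ g : ℝ → ℂ, ContDiffOn ℝ ∞ g (Icc 0 1) ∧
      ∀ x ∈ Ico (0 : ℝ) 1, g x = heunSeries d l m z x) := by
  obtain ⟨D, hD⟩ : ∃ D : ℝ, D = d - 2 := ⟨_, rfl⟩
  have hd' : (4 : ℝ) ≤ d := by exact_mod_cast hd
  have hl' : (1 : ℝ) ≤ l := by exact_mod_cast hl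
  have hD2 : 2 ≤ D := by linarith
  have hdD : (d : ℂ) = D + 2 := by rw [hD]; push_cast; ring
  have hp1 : ∀ n : ℕ, ((n : ℝ) + 1) / 2 ≤ (n : ℝ) / 2 + 1 := fun n => by linarith
  by_cases h1 : l = 1 ∧ m = (d : ℤ) - 1
  · have ha := isHeunSeq_of_l_one_of_m_max z hd h1 hD
    obtain ⟨n₀, hn⟩ := ha.inHalfPlane_of_l_one_of_m_max hD2 hz
    refine ha.properties hD2 (by linarith)
      (exists_half_plane_of_forall (p := fun n => ((n : ℝ) + 1) / 2) (fun _ => le_rfl) hn) ?_ ?_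
    all_goals intro x
    · rw [heunP, if_pos h1, hdD, ← div_div _ 2 ((x : ℂ) - 1)]; push_cast; ring
    · rw [heunQ, if_pos h1, hdD]; ring
  by_cases h2 : l = 1 ∧ m = 1
  · have ha := isHeunSeq_of_l_one_of_m_one z hd h1 h2 hD
    refine ha.properties hD2 (by linarith)
      (exists_half_plane_of_forall (p := fun n => ((n : ℝ) + 1) / 2) (fun _ => le_rfl)
        (ha.inHalfPlane_of_l_one_of_m_one hD2 hz)) ?_ ?_
    all_goals intro x
    · rw [heunP, if_neg h1, if_pos h2, hdD, ← div_div _ 2 ((x : ℂ) - 1)]; push_cast; ring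
    · rw [heunQ, if_neg h1, if_pos h2, hdD]; ring
  by_cases h3 : l = 2 ∧ m = (d : ℤ)
  · have ha := isHeunSeq_of_l_two_of_m_max z hd h1 h2 h3 hD
    refine ha.properties hD2 (by linarith)
      (exists_half_plane_of_forall hp1 (ha.inHalfPlane_of_l_two_of_m_max hD2 hz)) ?_ ?_
    all_goals intro x
    · rw [heunP, if_neg h1, if_neg h2, if_pos h3, hdD, ← div_div _ 2 ((x : ℂ) - 1)]; push_cast; ring
    · rw [heunQ, if_neg h1, if_neg h2, if_pos h3, hdD]; ring
  have ha := isHeunSeq_of_generic z hd h1 h2 h3 hD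
  have hone : InHalfPlane (heunCoeff d l m z) (D / 2 + 1 + (l : ℝ)) (z + ((l : ℝ) : ℂ) - 2)
      (3 / 2) 1 := by
    rcases hl.eq_or_lt with hl1 | hl2
    -- For l = 1 the other two values of m are the first two exceptional cases.
    · have hm1 : m = -1 := by omega
      subst hl1 hm1
      have ha' : IsHeunSeq D (D / 2 + 1 + 1) ((2 * z + 1 - D) / 2) (-2)
          (D * z ^ 2 + 3 * D * z + 8) (z * (z - 1)) (heunCoeff d 1 (-1) z) := by
        convert ha using 1 <;> push_cast <;> ring
      convert ha'.inHalfPlane_one_of_l_one hD2 hz using 1 <;> push_cast <;> ring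
    · refine ha.inHalfPlane_one_of_two_le hD2 (by exact_mod_cast hl2) ?_ hz
      -- The values -l and 1 are at most l; for m = l+d-2 the case l = 2 is the third exceptional
      -- one.
      have : m ≤ l ∨ 3 ≤ l ∧ m = l + d - 2 := by omega
      rcases this with h | ⟨h, hm'⟩
      · left; exact_mod_cast h
      · right
        refine ⟨by exact_mod_cast h, ?_⟩
        rw [hm', hD]; push_cast; linarith
  have hmle : (m : ℝ) ≤ l + D := by
    have : m ≤ l + d - 2 := by omega
    have : (m : ℝ) ≤ l + d - 2 := by exact_mod_cast this
    linarith
  refine ha.properties hD2 (by linarith)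
    (exists_half_plane_of_forall hp1 (ha.inHalfPlane_of_generic hD2 hl' hmle hz hone)) ?_ ?_
  all_goals intro x
  · rw [heunP, if_neg h1, if_neg h2, if_neg h3, hdD, ← div_div _ 2 ((x : ℂ) - 1)]; push_cast; ring
  · rw [heunQ, if_neg h1, if_neg h2, if_neg h3, hdD]; push_cast; ring
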